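/- For $K\subset\mathbb R^2$ nonempty and $r\ge 0$ let $K_r=\{x\in\mathbb R^2:\operatorname{dist}(x,K)\le r\}$. For $\varepsilon>0$ put $a_\varepsilon=2\varepsilon|\ln\varepsilon|$ and $b_\varepsilon=\varepsilon^2$. For $U\subset\mathbb R^2$ open let $$E_\varepsilon(\varphi;U)=\int_U \varepsilon|\nabla\varphi|^2+\frac{(1-\varphi)^2}{4\varepsilon}\,dx\in[0,\infty],$$ with $\nabla\varphi$ the weak gradient of $\varphi$ in $U$ (and $E_\varepsilon(\varphi;U)=+\infty$ if there is none). Given a number $k$, an $(\varepsilon,k)$-profile of $K$ is a function $\varphi\in H^1_{\rm loc}(\mathbb R^2)\cap C^0(\mathbb R^2)$ with $\varphi=k$ on $K_{b_\varepsilon}$ and $\varphi=1$ on $\mathbb R^2\setminus K_{a_\varepsilon+b_\varepsilon}$. (1) Let $K\subset\mathbb R^2$ be nonempty, compact and connected and let $k_\varepsilon\to0$ as $\varepsilon\to0^+$. Then there are functions $\varphi_\varepsilon$ such that $\varphi_\varepsilon$ is an $(\varepsilon,k_\varepsilon)$-profile of $K$ for every $\varepsilon>0$, $\varepsilon\ne1$,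 and $$\limsup_{\varepsilon\to0^+}E_\varepsilon(\varphi_\varepsilon;\mathbb R^2)\le\mathcal H^1(K).$$ (2) Let $\Omega\subset\mathbb R^2$ be open, bounded and star-shaped with respect to $0\in\Omega$, with Lipschitz boundary in the sense that the radial function $g_\Omega(u)=\sup\{t\ge0: tu\in\Omega\}$ is Lipschitz on the unit circle; let $\operatorname{Lip}(g_\Omega)$ be its best Lipschitz constant with respect to the Euclidean distance. The constants $$c(\Omega)=\tfrac14\min\{|x|:x\in\partial\Omega\},\qquad C(\Omega)=\frac1{4c(\Omega)}\Bigl(1+\frac{8\operatorname{Lip}(g_\Omega)}{c(\Omega)}\Bigr)$$ are positive, and the following holds. Let $K\subset\overline\Omega$ be nonempty, closed and connected, let $\varepsilon>0$ satisfy $a_\varepsilon+b_\varepsilon\le c(\Omega)$, let $\varphi$ be an $(\varepsilon,k)$-profile of $K$ for some $k\in\mathbb R$, let $\delta\in(0,1)$ satisfy $\delta\ge C(\Omega)(a_\varepsilon+b_\varepsilon)$, and put $\varphi_\delta(x)=\varphi((1+\delta)x)$. Then: (a) $(1+\delta)^{-1}K_{a_\varepsilon+b_\varepsilon}\subset\overline\Omega$,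 and even $(1+\delta)^{-1}K_{a_\varepsilon+b_\varepsilon}\subset\Omega$ if $\operatorname{Lip}(g_\Omega)>0$ or $\delta>C(\Omega)(a_\varepsilon+b_\varepsilon)$; (b) $\varphi_\delta\in H^1_{\rm loc}(\mathbb R^2)\cap C^0(\mathbb R^2)$ and $\varphi_\delta=1$ on $\partial\Omega$; (c) $E_\varepsilon(\varphi_\delta;\Omega)\le E_\varepsilon(\varphi;V)$ for every open set $V\supset K_{a_\varepsilon+b_\varepsilon}$ (in particular for $V=\mathbb R^2$, and for $V=\Omega$ if $K_{a_\varepsilon+b_\varepsilon}\subset\Omega$); (d) $E_\varepsilon(\varphi_\delta;(1+\delta)^{-1}\Omega)\le E_\varepsilon(\varphi;\Omega)$. -/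

import Mathlib

open MeasureTheory Filter Topology Set
open scoped Pointwise NNReal ENNReal ContDiff

noncomputable section

/-- The Euclidean plane. -/
abbrev Plane : Type := EuclideanSpace ℝ (Fin 2)

/-- `G` is a weak (distributional) gradient of `φ` in the open set `U`. -/
structure IsWeakGradientOn (φ : Plane → ℝ) (G : Plane → Plane) (U : Set Plane) : Prop where
  locInt : LocallyIntegrableOn φ U volume
  locInt_grad : LocallyIntegrableOn G U volume
  integral_eq : ∀ η : Plane → ℝ, ContDiff ℝ ∞ η → HasCompactSupport η → tsupport η ⊆ U →
    ∀ e : Plane, ∫ x, φ x * fderiv ℝ η x e = - ∫ x, inner ℝ (G x) e * η x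

/-- The local Sobolev space `H¹_loc(ℝ²) = W^{1,2}_loc(ℝ²)`. -/
def MemH1Loc (φ : Plane → ℝ) : Prop :=
  LocallyIntegrable (fun x => (φ x) ^ 2) volume ∧
    ∃ G : Plane → Plane, IsWeakGradientOn φ G univ ∧
      LocallyIntegrable (fun x => ‖G x‖ ^ 2) volume

/-- The energy `∫_U ε |∇φ|² + (1 - φ)² / (4 ε)`, where `∇φ` is the weak gradient of `φ` in the
open set `U`. Weak gradients are unique up to null sets, so the infimum is over at most one
value; it is `∞` if `φ` has no weak gradient in `U`. -/
def modicaMortola (ε : ℝ) (U : Set Plane) (φ : Plane → ℝ) : ℝ≥0∞ :=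
  ⨅ (G : Plane → Plane) (_ : IsWeakGradientOn φ G U),
    ∫⁻ x in U, ENNReal.ofReal (ε * ‖G x‖ ^ 2 + (1 - φ x) ^ 2 / (4 * ε))

/-- The radial function `g_Ω(u) = sup {t ≥ 0 : t u ∈ Ω}` of a set star-shaped about `0`,
of interest for unit vectors `u`. -/
def radial (Ω : Set Plane) (u : Plane) : ℝ := sSup {t : ℝ | 0 ≤ t ∧ t • u ∈ Ω}

/-- A bounded open set, star-shaped with respect to `0 ∈ Ω`, whose boundary is the graph
`{g(u) u : |u| = 1}` of a Lipschitz function `g` on the unit circle. -/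
structure IsLipschitzStarDomain (Ω : Set Plane) : Prop where
  isOpen : IsOpen Ω
  isBounded : Bornology.IsBounded Ω
  zero_mem : (0 : Plane) ∈ Ω
  starConvex : StarConvex ℝ (0 : Plane) Ω
  lipschitz : ∃ L : ℝ≥0, LipschitzOnWith L (radial Ω) (Metric.sphere 0 1)

/-- The radial function of a domain `Ω` as above satisfies
`Ω \ {0} = {x ≠ 0 : |x| < g_Ω(x / |x|)}`. -/
theorem IsLipschitzStarDomain.mem_iff {Ω : Set Plane} (h : IsLipschitzStarDomain Ω)
    {x : Plane} (hx : x ≠ 0) : x ∈ Ω ↔ ‖x‖ < radial Ω (‖x‖⁻¹ • x) := by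
  have hn : 0 < ‖x‖ := norm_pos_iff.mpr hx
  have hxx : ‖x‖ • (‖x‖⁻¹ • x) = x := smul_inv_smul₀ hn.ne' x
  constructor
  · intro hm
    have hc : ContinuousAt (fun t : ℝ => t • (‖x‖⁻¹ • x)) ‖x‖ := by fun_prop
    have hev : ∀ᶠ t in 𝓝 ‖x‖, t • (‖x‖⁻¹ • x) ∈ Ω :=
      hc.eventually (h.isOpen.mem_nhds (by simpa only [hxx] using hm))
    obtain ⟨t, ht, htx⟩ := ((hev.filter_mono nhdsWithin_le_nhds).and
      (self_mem_nhdsWithin : Ioi ‖x‖ ∈ 𝓝[>] ‖x‖)).exists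
    obtain ⟨R, hR⟩ := h.isBounded.exists_norm_le
    have hb : BddAbove {t : ℝ | 0 ≤ t ∧ t • (‖x‖⁻¹ • x) ∈ Ω} := by
      refine ⟨R, fun s hs => ?_⟩
      have h2 := hR _ hs.2
      rw [norm_smul, norm_smul, norm_inv, norm_norm, inv_mul_cancel₀ hn.ne', mul_one,
        Real.norm_of_nonneg hs.1] at h2
      exact h2
    exact lt_of_lt_of_le htx (le_csSup hb ⟨hn.le.trans (le_of_lt htx), ht⟩)
  · intro hm
    obtain ⟨t, ⟨ht0, ht⟩, hlt⟩ := exists_lt_of_lt_csSup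
      (⟨0, le_rfl, by simpa only [zero_smul] using h.zero_mem⟩ :
        {t : ℝ | 0 ≤ t ∧ t • (‖x‖⁻¹ • x) ∈ Ω}.Nonempty) hm
    have htp : 0 < t := hn.trans hlt
    have hs := h.starConvex.smul_mem ht (div_nonneg hn.le ht0) ((div_le_one htp).mpr hlt.le)
    rwa [smul_smul, div_mul_cancel₀ _ htp.ne', hxx] at hs

/-- The best Lipschitz constant `Lip(g_Ω)` of the radial function on the unit circle. -/
def radialLip (Ω : Set Plane) : ℝ≥0 :=
  sInf {L : ℝ≥0 | LipschitzOnWith L (radial Ω) (Metric.sphere 0 1)}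

/-- `c(Ω) = min {|x| : x ∈ ∂Ω} / 4`. -/
def cConst (Ω : Set Plane) : ℝ := Metric.infDist 0 (frontier Ω) / 4

/-- `C(Ω) = (1 + 8 Lip(g_Ω) / c(Ω)) / (4 c(Ω))`. -/
def CConst (Ω : Set Plane) : ℝ :=
  1 / (4 * cConst Ω) * (1 + 8 * (radialLip Ω : ℝ) / cConst Ω)

/-- The parameter `a_ε = 2 ε |ln ε|`. -/
def aPar (ε : ℝ) : ℝ := 2 * ε * |Real.log ε|

/-- The parameter `b_ε = ε²`. -/
def bPar (ε : ℝ) : ℝ := ε ^ 2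

/-- `φ` is an admissible profile around `K`: a continuous `H¹_loc` function equal to `k` on the
closed `b_ε`-neighbourhood of `K` and to `1` off the closed `(a_ε + b_ε)`-neighbourhood. -/
structure IsProfile (K : Set Plane) (ε k : ℝ) (φ : Plane → ℝ) : Prop where
  continuous : Continuous φ
  memH1Loc : MemH1Loc φ
  eq_inside : ∀ x ∈ Metric.cthickening (bPar ε) K, φ x = k
  eq_outside : ∀ x ∉ Metric.cthickening (aPar ε + bPar ε) K, φ x = 1

/-- The contraction `φ_δ(x) = φ((1 + δ) x)` towards the origin. -/
def contracted (δ : ℝ) (φ : Plane → ℝ) : Plane → ℝ := fun x => φ ((1 + δ) • x)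

end

/-!
For the first part, let `K` be a continuum with `H = ℋ¹(K) < ∞`. The main point is the sharp
bound `|K_r| ≤ 2 r H + π r²` for the tubes around `K` (`IsConnected.hasTubeBound`). It holds for
points. It survives the attachment of a simple arc at an endpoint (`HasTubeBound.union_curve`),
because the tube around the arc, outside the disc around the attached endpoint, has area at most
`2 r` times the length: it is swept out by crescents between translated discs, and the length of
a simple arc is at most `ℋ¹` of its image. Any finite subset of `K` lies in a tree of such arcs
inside `K`: from a new point, follow a Lipschitz curve in `K` with least constant to the part
already built. That such curves exist is compactness plus the fact that a connected set of finite
length is joined by chains of `O(1 / δ)` steps of size `δ` (`exists_chain`); minimality makes the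
curve injective and disjoint from the old part up to its endpoint
(`exists_injective_isCurveTo`). So the bound holds for trees that contain arbitrarily fine nets of
`K`, hence for `K`.

The profile is the truncated optimal exponential in the distance `d` to `K`. Its energy density is
at most `(1 + o(1)) e^{-d / ε} / (2 ε)` on the whole plane, and the layer-cake formula together
with the tube bound gives `∫ e^{-d / ε} / (2 ε) ≤ H + π ε`
(`HasTubeBound.lintegral_exp_infDist_le`).

For the second part, the radial function changes by at most `2 Lip(g_Ω) |x - y| / |x|` between the
directions of `x` and `y`. A point within `r = a_ε + b_ε` of `K` is therefore at most
`(1 + 8 Lip(g_Ω) / c(Ω)) r` beyond the boundary of `Ω`, which is what the contraction by `1 + δ`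
compensates (`IsLipschitzStarDomain.inv_smul_mem_of_dist_le`). In the plane the Dirichlet integral
is invariant under dilations, while contraction decreases the potential term
(`modicaMortola_contracted_le`). Finally, by uniqueness of weak gradients, the energy of a profile
vanishes outside `K_r`, so it can be computed in any open set containing `K_r`
(`modicaMortola_le_of_eq_one_off`).
-/

/-! ### Tubes around simple curves -/

/-- A disc minus its translate by `p - q`: each line parallel to `p - q` that meets the disc meets the difference in a segment of length at most `|p - q|`, and these lines fill a strip of
width `2 r`. -/
theorem volume_closedBall_diff_closedBall_le (p q : Plane) {r : ℝ} (hr : 0 ≤ r) :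
    volume (Metric.closedBall q r \ Metric.closedBall p r) ≤ ENNReal.ofReal (2 * r * dist p q) := by
  rcases eq_or_ne p q with rfl | hpq
  · simp
  have hl : 0 < dist p q := dist_pos.mpr hpq
  set l := dist p q with hl_def
  set u : Plane := l⁻¹ • (q - p) with hu
  have hun : ‖u‖ = 1 := by
    rw [hu, norm_smul, norm_inv, Real.norm_of_nonneg hl.le, ← dist_eq_norm, dist_comm q p]
    exact inv_mul_cancel₀ hl.ne'
  have hq : q = p + l • u := by
    rw [hu, smul_inv_smul₀ hl.ne']; abel
  have hou : Orthonormal ℝ (({0} : Set (Fin 2)).domRestrict (fun _ : Fin 2 => u)) := by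
    constructor
    · intro i; exact hun
    · intro i j hij; exact absurd (Subsingleton.elim i j) hij
  -- An orthonormal basis with first vector `u`, the direction from `p` to `q`.
  obtain ⟨b, hb⟩ := hou.exists_orthonormalBasis_extension_of_card_eq (by simp)
  have hb0 : b 0 = u := hb 0 rfl
  set Φ : Plane → ℝ × ℝ := fun x => (b.repr (x - p) 1, b.repr (x - p) 0) with hΦ
  have hΦm : MeasurePreserving Φ volume volume := by
    have h1 : MeasurePreserving (fun x : Plane => x - p) volume volume :=
      measurePreserving_sub_right volume p
    have h2 := b.measurePreserving_repr
    have h3 := PiLp.volume_preserving_ofLp (Fin 2)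
    have h4 := volume_preserving_finTwoArrow ℝ
    have h5 : MeasurePreserving (Prod.swap : ℝ × ℝ → ℝ × ℝ) volume volume :=
      Measure.measurePreserving_swap
    exact h5.comp (h4.comp (h3.comp (h2.comp h1)))
  set f : ℝ → ℝ := fun v => Real.sqrt (r ^ 2 - v ^ 2) with hf
  set g : ℝ → ℝ := fun v => Real.sqrt (r ^ 2 - v ^ 2) + l with hg
  have hnorm : ∀ y : Plane, ‖y‖ ^ 2 = (b.repr y 1) ^ 2 + (b.repr y 0) ^ 2 := by
    intro y
    rw [← b.repr.norm_map y, EuclideanSpace.norm_sq_eq]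
    simp [Fin.sum_univ_two, add_comm]
  have hsub : Metric.closedBall q r \ Metric.closedBall p r ⊆
      Metric.sphere q r ∪ Φ ⁻¹' (regionBetween f g (Icc (-r) r)) := by
    rintro x ⟨hx1, hx2⟩
    rw [Metric.mem_closedBall, dist_eq_norm] at hx1 hx2
    rcases hx1.eq_or_lt with h | h
    · left; rwa [Metric.mem_sphere, dist_eq_norm]
    right
    have e1 : ‖x - p‖ ^ 2 = (b.repr (x - p) 1) ^ 2 + (b.repr (x - p) 0) ^ 2 := hnorm _
    have e2 : ‖x - q‖ ^ 2 = (b.repr (x - p) 1) ^ 2 + (b.repr (x - p) 0 - l) ^ 2 := by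
      have : x - q = (x - p) - l • b 0 := by rw [hb0, hq]; abel
      rw [this, hnorm]
      simp
    have e3 : r ^ 2 < ‖x - p‖ ^ 2 := by
      push Not at hx2
      exact pow_lt_pow_left₀ hx2 hr (by norm_num)
    have e4 : ‖x - q‖ ^ 2 < r ^ 2 := pow_lt_pow_left₀ h (norm_nonneg _) (by norm_num)
    simp only [mem_preimage, hΦ, regionBetween, mem_ofPred_eq]
    obtain ⟨v, hv⟩ : ∃ v, v = b.repr (x - p) 1 := ⟨_, rfl⟩
    obtain ⟨a, ha⟩ : ∃ a, a = b.repr (x - p) 0 := ⟨_, rfl⟩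
    rw [← hv, ← ha] at e1 e2 ⊢
    have ha0 : 0 < a := by nlinarith
    refine ⟨?_, ?_, ?_⟩
    · exact abs_le.mp (abs_le_of_sq_le_sq (by nlinarith) hr)
    · exact (Real.sqrt_lt' ha0).mpr (by nlinarith)
    · have := Real.lt_sqrt_of_sq_lt (x := a - l) (y := r ^ 2 - v ^ 2) (by nlinarith)
      simp only [hg]; linarith
  have hfm : Measurable f := by fun_prop
  have hgm : Measurable g := by fun_prop
  calc volume (Metric.closedBall q r \ Metric.closedBall p r)
      ≤ volume (Metric.sphere q r) + volume (Φ ⁻¹' (regionBetween f g (Icc (-r) r))) :=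
        (measure_mono hsub).trans (measure_union_le _ _)
    _ = volume (regionBetween f g (Icc (-r) r)) := by
        rw [Measure.addHaar_sphere, zero_add, hΦm.measure_preimage
          (measurableSet_regionBetween hfm hgm measurableSet_Icc).nullMeasurableSet]
    _ = ENNReal.ofReal (2 * r * l) := by
        have : (volume : Measure (ℝ × ℝ)) = (volume : Measure ℝ).prod volume := rfl
        rw [this, volume_regionBetween_eq_lintegral hfm.aemeasurable hgm.aemeasurable
          measurableSet_Icc]
        simp only [hf, hg, Pi.sub_apply, add_sub_cancel_left, lintegral_const,
          Measure.restrict_apply MeasurableSet.univ, univ_inter, Real.volume_Icc]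
        rw [← ENNReal.ofReal_mul hl.le]
        congr 1; ring

/-- The distance to `p` maps `C` onto a set containing the interval `[0, |p - q|]`. -/
theorem edist_le_hausdorffMeasure_one {C : Set Plane} (hC : IsPreconnected C) {p q : Plane}
    (hp : p ∈ C) (hq : q ∈ C) : edist p q ≤ Measure.hausdorffMeasure 1 C := by
  have hlip : LipschitzWith 1 (fun x : Plane => dist x p) := LipschitzWith.dist_left p
  have h1 := hlip.hausdorffMeasure_image_le zero_le_one C
  rw [hausdorffMeasure_real] at h1
  have h2 : Icc 0 (dist q p) ⊆ (fun x : Plane => dist x p) '' C := by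
    have := (hC.image _ hlip.continuous.continuousOn).ordConnected.out
      (mem_image_of_mem _ hp) (mem_image_of_mem _ hq)
    simpa using this
  have h3 := measure_mono (μ := volume) h2
  rw [Real.volume_Icc, sub_zero, ← edist_dist, edist_comm] at h3
  simpa using h3.trans h1

/-- The difference is covered by the crescents between the discs around consecutive points. -/
theorem volume_biUnion_closedBall_diff_le (p : ℕ → Plane) {r : ℝ} (hr : 0 ≤ r) (n : ℕ) :
    volume ((⋃ i ∈ Finset.range (n + 1), Metric.closedBall (p i) r) \ Metric.closedBall (p n) r) ≤
      ENNReal.ofReal (2 * r) * ∑ i ∈ Finset.range n, edist (p i) (p (i + 1)) := by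
  induction n with
  | zero => simp
  | succ n ih =>
    -- A point outside the last disc is outside the disc around `p n` or in the last crescent.
    have hsub : (⋃ i ∈ Finset.range (n + 1 + 1), Metric.closedBall (p i) r) \
        Metric.closedBall (p (n + 1)) r ⊆
        ((⋃ i ∈ Finset.range (n + 1), Metric.closedBall (p i) r) \ Metric.closedBall (p n) r) ∪
        (Metric.closedBall (p n) r \ Metric.closedBall (p (n + 1)) r) := by
      rw [Finset.range_add_one, Finset.set_biUnion_insert]
      rintro x ⟨hx | hx, hx'⟩
      · exact absurd hx hx'
      · by_cases h : x ∈ Metric.closedBall (p n) r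
        · exact Or.inr ⟨h, hx'⟩
        · exact Or.inl ⟨hx, h⟩
    refine (measure_mono hsub).trans ((measure_union_le _ _).trans ?_)
    rw [Finset.sum_range_succ, mul_add]
    refine add_le_add ih ((volume_closedBall_diff_closedBall_le _ _ hr).trans_eq ?_)
    rw [ENNReal.ofReal_mul (by positivity), edist_dist, dist_comm]

/-- Inscribed polygons of a simple curve are no longer than `ℋ¹` of its image: by injectivity,
consecutive subarcs are disjoint up to endpoints. -/
theorem sum_edist_le_hausdorffMeasure {γ : ℝ → Plane} (hc : ContinuousOn γ (Icc 0 1))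
    (hi : InjOn γ (Icc 0 1)) (n : ℕ) :
    ∑ i ∈ Finset.range n, edist (γ (i / n)) (γ ((i + 1 : ℕ) / n)) ≤
      Measure.hausdorffMeasure 1 (γ '' Icc 0 1) := by
  rcases Nat.eq_zero_or_pos n with rfl | hn
  · simp
  have hn' : (0 : ℝ) < n := by exact_mod_cast hn
  set I : ℕ → Set ℝ := fun i => Ico (i / n : ℝ) ((i + 1 : ℕ) / n) with hI
  have hIsub : ∀ i ∈ Finset.range n, Icc (i / n : ℝ) ((i + 1 : ℕ) / n) ⊆ Icc 0 1 := by
    intro i hi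
    refine Icc_subset_Icc (by positivity) ?_
    rw [div_le_one hn']
    exact_mod_cast Finset.mem_range.mp hi
  have hIm : ∀ i ∈ Finset.range n, MeasurableSet (γ '' I i) := fun i hin =>
    measurableSet_Ico.image_of_continuousOn_injOn
      (hc.mono (Ico_subset_Icc_self.trans (hIsub i hin)))
      (hi.mono (Ico_subset_Icc_self.trans (hIsub i hin)))
  have hdisj : (↑(Finset.range n) : Set ℕ).PairwiseDisjoint (fun i => γ '' I i) := by
    intro i hin j hjn hij
    have hin' := Ico_subset_Icc_self.trans (hIsub i hin)
    have hjn' := Ico_subset_Icc_self.trans (hIsub j hjn)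
    refine Set.disjoint_left.mpr ?_
    rintro _ ⟨x, hx, rfl⟩ ⟨y, hy, hxy⟩
    obtain rfl : y = x := hi (hjn' hy) (hin' hx) hxy
    obtain ⟨⟨h1, h2⟩, h3, h4⟩ := And.intro hx hy
    rw [div_le_iff₀ hn'] at h1 h3
    rw [lt_div_iff₀ hn'] at h2 h4
    have a1 : i < j + 1 := by exact_mod_cast h1.trans_lt h4
    have a2 : j < i + 1 := by exact_mod_cast h3.trans_lt h2
    omega
  calc ∑ i ∈ Finset.range n, edist (γ (i / n)) (γ ((i + 1 : ℕ) / n))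
      ≤ ∑ i ∈ Finset.range n, Measure.hausdorffMeasure 1 (γ '' I i) := by
        refine Finset.sum_le_sum fun i hin => ?_
        have hle : (i / n : ℝ) ≤ ((i + 1 : ℕ) / n) := by gcongr; simp
        have h1 := edist_le_hausdorffMeasure_one
          (isPreconnected_Icc.image γ (hc.mono (hIsub i hin)))
          (mem_image_of_mem γ (left_mem_Icc.mpr hle)) (mem_image_of_mem γ (right_mem_Icc.mpr hle))
        refine h1.trans ?_
        rw [← Ico_insert_right hle, image_insert_eq]
        have := Measure.nullSingletonClass_hausdorff Plane one_pos
        exact (measure_congr (insert_ae_eq_self _ _)).le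
    _ = Measure.hausdorffMeasure 1 (⋃ i ∈ Finset.range n, γ '' I i) :=
        (measure_biUnion_finset hdisj hIm).symm
    _ ≤ Measure.hausdorffMeasure 1 (γ '' Icc 0 1) := by
        refine measure_mono (iUnion₂_subset fun i hin => image_mono ?_)
        exact Ico_subset_Icc_self.trans (hIsub i hin)

/-- The tube of radius `r` around a simple curve has area at most `2 r` times its length, up to the
disc around an endpoint. The slack `η` in the radius pays for replacing the curve by finitely many
of its points. -/
theorem volume_cthickening_curve_diff_le {γ : ℝ → Plane} {L : ℝ≥0}
    (hL : LipschitzOnWith L γ (Icc 0 1)) (hi : InjOn γ (Icc 0 1)) {r η : ℝ} (hr : 0 ≤ r)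
    (hη : 0 < η) :
    volume (Metric.cthickening r (γ '' Icc 0 1) \ Metric.closedBall (γ 1) (r + η)) ≤
      ENNReal.ofReal (2 * (r + η)) * Measure.hausdorffMeasure 1 (γ '' Icc 0 1) := by
  obtain ⟨n, hn⟩ := exists_nat_gt (max (L / η : ℝ) 1)
  have hn1 : (1 : ℝ) < n := (le_max_right _ _).trans_lt hn
  have hn0 : (0 : ℝ) < n := by linarith
  have hnL : L * (1 / n : ℝ) ≤ η := by
    have := ((le_max_left _ _).trans_lt hn).le
    rw [div_le_iff₀ hη] at this
    rw [mul_one_div, div_le_iff₀ hn0]; linarith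
  have hsub : Metric.cthickening r (γ '' Icc 0 1) ⊆
      ⋃ i ∈ Finset.range (n + 1), Metric.closedBall (γ (i / n)) (r + η) := by
    rw [(isCompact_Icc.image_of_continuousOn hL.continuousOn).cthickening_eq_biUnion_closedBall hr]
    refine iUnion₂_subset ?_
    rintro _ ⟨t, ht, rfl⟩ x hx
    have ht0 : 0 ≤ t * n := by have := ht.1; positivity
    have h1 : (⌊t * n⌋₊ : ℝ) ≤ t * n := Nat.floor_le ht0
    have h2 : t * n < ⌊t * n⌋₊ + 1 := Nat.lt_floor_add_one _
    have h3 : ⌊t * n⌋₊ ≤ n := by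
      have : t * n ≤ n := by nlinarith [ht.2]
      exact_mod_cast h1.trans this
    refine mem_iUnion₂.mpr ⟨⌊t * n⌋₊, Finset.mem_range.mpr (by omega), ?_⟩
    have h4 : dist (γ t) (γ (⌊t * n⌋₊ / n)) ≤ η := by
      refine (hL.dist_le_mul t ht _ ⟨by positivity, ?_⟩).trans (le_trans ?_ hnL)
      · rw [div_le_one hn0]; exact_mod_cast h3
      · gcongr
        have h5 : (⌊t * n⌋₊ : ℝ) / n ≤ t := by rwa [div_le_iff₀ hn0]
        rw [Real.dist_eq, abs_of_nonneg (by linarith), sub_le_iff_le_add, ← add_div,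
          le_div_iff₀ hn0]
        linarith
    exact (dist_triangle x _ _).trans (add_le_add hx h4)
  have h1 := volume_biUnion_closedBall_diff_le (fun i => γ (i / n)) (by positivity : 0 ≤ r + η) n
  have h2 : γ (n / n) = γ 1 := by rw [div_self hn0.ne']
  simp only [h2] at h1
  refine (measure_mono (sdiff_subset_sdiff_left hsub)).trans (h1.trans ?_)
  gcongr
  exact sum_edist_le_hausdorffMeasure hL.continuousOn hi n

/-! ### Shortest curves in continua of finite length -/

/-- `γ : [0, 1] → K` is a Lipschitz curve with constant `L` that starts at `p` and ends in `T`.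
The values of `γ` outside `[0, 1]` are irrelevant. -/
structure IsCurveTo (K T : Set Plane) (p : Plane) (L : ℝ) (γ : ℝ → Plane) : Prop where
  mem : ∀ t ∈ Icc (0 : ℝ) 1, γ t ∈ K
  dist_le : ∀ s ∈ Icc (0 : ℝ) 1, ∀ t ∈ Icc (0 : ℝ) 1, dist (γ s) (γ t) ≤ L * |s - t|
  zero : γ 0 = p
  one : γ 1 ∈ T

/-- Compactness of Lipschitz curves, allowing discontinuous approximations with an error tending to
zero. The limit is taken pointwise along an ultrafilter, so no subsequence has to be extracted. -/
theorem exists_isCurveTo_of_approx {K T : Set Plane} (hK : IsCompact K) (hT : IsClosed T)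
    {p : Plane} {l e : ℕ → ℝ} {L : ℝ} (hl : Tendsto l atTop (𝓝 L)) (he : Tendsto e atTop (𝓝 0))
    (γ : ℕ → ℝ → Plane) (hγK : ∀ m, ∀ t ∈ Icc (0 : ℝ) 1, γ m t ∈ K)
    (hγ : ∀ m, ∀ s ∈ Icc (0 : ℝ) 1, ∀ t ∈ Icc (0 : ℝ) 1,
      dist (γ m s) (γ m t) ≤ l m * |s - t| + e m)
    (h0 : ∀ m, γ m 0 = p) (h1 : ∀ m, γ m 1 ∈ T) : ∃ γ, IsCurveTo K T p L γ := by
  have hU : (hyperfilter ℕ : Filter ℕ) ≤ atTop := Nat.hyperfilter_le_atTop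
  have hlim : ∀ t : ℝ, ∃ z, t ∈ Icc (0 : ℝ) 1 →
      z ∈ K ∧ Tendsto (fun m => γ m t) (hyperfilter ℕ) (𝓝 z) := by
    intro t
    by_cases ht : t ∈ Icc (0 : ℝ) 1
    · obtain ⟨z, hz, hz'⟩ := hK.ultrafilter_le_nhds ((hyperfilter ℕ).map fun m => γ m t)
        (le_principal_iff.mpr (Ultrafilter.mem_map.mpr (univ_mem' fun m => hγK m t ht)))
      exact ⟨z, fun _ => ⟨hz, hz'⟩⟩
    · exact ⟨0, fun h => absurd h ht⟩
  choose g hg using hlim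
  refine ⟨g, fun t ht => (hg t ht).1, fun s hs t ht => ?_, ?_, ?_⟩
  · have h2 : Tendsto (fun m => l m * |s - t| + e m) (hyperfilter ℕ) (𝓝 (L * |s - t| + 0)) :=
      ((hl.mono_left hU).mul_const _).add (he.mono_left hU)
    rw [add_zero] at h2
    exact le_of_tendsto_of_tendsto ((hg s hs).2.dist (hg t ht).2) h2
      (Eventually.of_forall fun m => hγ m s hs t ht)
  · have h3 := (hg 0 (by simp)).2
    simp only [h0] at h3
    exact tendsto_nhds_unique h3 tendsto_const_nhds
  · exact hT.mem_of_tendsto (hg 1 (by simp)).2 (Eventually.of_forall h1)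

/-- A connected set that reaches from `v` to distance `ρ` has length at least `ρ` in the ball of
radius `ρ` around `v`. -/
theorem ofReal_le_hausdorffMeasure_inter_ball {K : Set Plane} (hK : IsPreconnected K)
    {v w : Plane} (hv : v ∈ K) (hw : w ∈ K) {ρ : ℝ} (hρ : ρ ≤ dist w v) :
    ENNReal.ofReal ρ ≤ Measure.hausdorffMeasure 1 (K ∩ Metric.ball v ρ) := by
  have hlip : LipschitzWith 1 (fun x : Plane => dist x v) := LipschitzWith.dist_left v
  have h1 := hlip.hausdorffMeasure_image_le zero_le_one (K ∩ Metric.ball v ρ)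
  rw [hausdorffMeasure_real] at h1
  have h2 : Ico 0 ρ ⊆ (fun x : Plane => dist x v) '' (K ∩ Metric.ball v ρ) := by
    rintro t ⟨ht0, ht⟩
    have h3 := (hK.image _ hlip.continuous.continuousOn).ordConnected.out
      (mem_image_of_mem _ hv) (mem_image_of_mem _ hw)
    obtain ⟨x, hx, rfl⟩ := h3 ⟨by simpa using ht0, ht.le.trans hρ⟩
    exact ⟨x, ⟨hx, ht⟩, rfl⟩
  have h4 := measure_mono (μ := volume) h2
  rw [Real.volume_Ico, sub_zero] at h4
  simpa using h4.trans h1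

/-- Two points of a connected set are joined by a chain of short steps in that set. A shortest
chain visits pairwise distant points at its even steps, and the set has length at least `δ / 2`
near each of them, so the chain has at most `4 H / δ` steps. -/
theorem exists_chain {K : Set Plane} (hK : IsCompact K) (hKc : IsPreconnected K) {H : ℝ}
    (hH : Measure.hausdorffMeasure 1 K ≤ ENNReal.ofReal H) {x y : Plane}
    (hx : x ∈ K) (hy : y ∈ K) {δ : ℝ} (hδ : 0 < δ) (hδxy : δ ≤ dist x y) :
    ∃ (n : ℕ) (v : ℕ → Plane), v 0 = x ∧ v n = y ∧ (∀ i, v i ∈ K) ∧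
      (∀ i, dist (v i) (v (i + 1)) ≤ δ) ∧ n * δ ≤ 4 * H := by
  let G : SimpleGraph K :=
    { Adj := fun a b => a ≠ b ∧ dist a b ≤ δ
      symm := ⟨fun a b h => ⟨h.1.symm, by rw [dist_comm]; exact h.2⟩⟩
      loopless := ⟨fun a h => h.1 rfl⟩ }
  have hadj : ∀ a b : K, dist a b ≤ δ → G.Reachable a b := by
    intro a b h
    rcases eq_or_ne a b with rfl | hab
    · exact SimpleGraph.Reachable.refl _
    · exact SimpleGraph.Adj.reachable ⟨hab, h⟩
  have : PreconnectedSpace K := isPreconnected_iff_preconnectedSpace.mp hKc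
  have hreach : ∀ z : K, G.Reachable ⟨x, hx⟩ z := by
    have hclopen : IsClopen {z : K | G.Reachable ⟨x, hx⟩ z} := by
      constructor
      · rw [← isOpen_compl_iff, Metric.isOpen_iff]
        intro z hz
        refine ⟨δ, hδ, fun w hw hw' => hz ?_⟩
        exact SimpleGraph.Reachable.trans hw' (hadj _ _ (le_of_lt hw))
      · rw [Metric.isOpen_iff]
        intro z hz
        refine ⟨δ, hδ, fun w hw => ?_⟩
        exact SimpleGraph.Reachable.trans hz (hadj _ _ (by rw [dist_comm]; exact le_of_lt hw))
    have huniv := hclopen.eq_univ ⟨⟨x, hx⟩, SimpleGraph.Reachable.refl _⟩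
    exact fun z => (huniv ▸ mem_univ z : z ∈ {z : K | G.Reachable ⟨x, hx⟩ z})
  obtain ⟨p, hp⟩ := (hreach ⟨y, hy⟩).exists_walk_length_eq_dist
  set n := p.length with hn
  have hfar : ∀ i j, i + 2 ≤ j → j ≤ n → δ < dist (p.getVert i) (p.getVert j) := by
    intro i j hij hjn
    by_contra! hle
    -- Otherwise a walk of at most one step would shortcut the shortest walk `p`.
    have h1 : ∃ q : G.Walk (p.getVert i) (p.getVert j), q.length ≤ 1 := by
      by_cases hne : p.getVert i = p.getVert j
      · rw [hne]; exact ⟨SimpleGraph.Walk.nil, by simp⟩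
      · exact ⟨SimpleGraph.Walk.cons ⟨hne, hle⟩ SimpleGraph.Walk.nil, by simp⟩
    obtain ⟨q, hq⟩ := h1
    have h2 := G.dist_le ((p.take i).append (q.append (p.drop j)))
    simp only [SimpleGraph.Walk.length_append, SimpleGraph.Walk.take_length,
      SimpleGraph.Walk.drop_length] at h2
    omega
  refine ⟨n, fun i => p.getVert i, by simp, by simp [hn], fun i => (p.getVert i).2, ?_, ?_⟩
  · intro i
    rcases lt_or_ge i n with h | h
    · exact (p.adj_getVert_succ h).2
    · beta_reduce
      rw [p.getVert_of_length_le h, p.getVert_of_length_le (by omega), dist_self]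
      exact hδ.le
  · set B : ℕ → Set Plane := fun i => K ∩ Metric.ball (p.getVert (2 * i) : Plane) (δ / 2)
    have hBm : ∀ i ∈ Finset.range (n / 2 + 1), MeasurableSet (B i) := fun i _ =>
      hK.measurableSet.inter measurableSet_ball
    have key : ∀ i j, i < j → j ≤ n / 2 → Disjoint (B i) (B j) := by
      intro i j hij hj
      have h1 := hfar (2 * i) (2 * j) (by omega) (by omega)
      refine (Metric.ball_disjoint_ball ?_).mono inter_subset_right inter_subset_right
      rw [add_halves]; exact h1.le
    have hBd : (↑(Finset.range (n / 2 + 1)) : Set ℕ).PairwiseDisjoint B := by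
      intro i hi j hj hij
      simp only [Finset.coe_range, mem_Iio] at hi hj
      rcases lt_or_gt_of_ne hij with h | h
      · exact key i j h (by omega)
      · exact (key j i h (by omega)).symm
    have hB : ∀ i ∈ Finset.range (n / 2 + 1), ENNReal.ofReal (δ / 2) ≤
        Measure.hausdorffMeasure 1 (B i) := by
      intro i _
      -- As `|x - y| ≥ δ`, one of `x`, `y` has distance at least `δ / 2` from the centre.
      have h1 : δ / 2 ≤ dist x (p.getVert (2 * i)) ∨ δ / 2 ≤ dist y (p.getVert (2 * i)) := by
        by_contra! h
        have := dist_triangle_right x y (p.getVert (2 * i) : Plane)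
        linarith [h.1, h.2]
      rcases h1 with h | h
      · exact ofReal_le_hausdorffMeasure_inter_ball hKc (p.getVert (2 * i)).2 hx h
      · exact ofReal_le_hausdorffMeasure_inter_ball hKc (p.getVert (2 * i)).2 hy h
    have h2 : ∑ i ∈ Finset.range (n / 2 + 1), ENNReal.ofReal (δ / 2) ≤ ENNReal.ofReal H := by
      refine (Finset.sum_le_sum hB).trans ?_
      rw [← measure_biUnion_finset hBd hBm]
      exact (measure_mono (iUnion₂_subset fun i _ => inter_subset_left)).trans hH
    rw [Finset.sum_const, Finset.card_range, ← ENNReal.ofReal_nsmul] at h2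
    have h3 : (n / 2 + 1) • (δ / 2) ≤ H :=
      (ENNReal.ofReal_le_ofReal_iff'.mp h2).resolve_right (by
        rw [not_le]; exact nsmul_pos (by positivity) (by omega))
    rw [nsmul_eq_mul] at h3
    have h4 : (n : ℝ) ≤ 2 * ((n / 2 + 1 : ℕ) : ℝ) := by
      have : n ≤ 2 * (n / 2 + 1) := by omega
      exact_mod_cast this
    have := mul_le_mul_of_nonneg_right h4 hδ.le
    linarith

/-- Chains with ever shorter steps, traversed at constant speed, are approximate Lipschitz curves
with a uniform constant. -/
theorem exists_isCurveTo {K T : Set Plane} (hK : IsCompact K) (hKc : IsPreconnected K)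
    (hT : IsClosed T) {H : ℝ} (hH : Measure.hausdorffMeasure 1 K ≤ ENNReal.ofReal H)
    {x y : Plane} (hx : x ∈ K) (hy : y ∈ K) (hyT : y ∈ T) (hxy : x ≠ y) :
    ∃ γ, IsCurveTo K T x (4 * H) γ := by
  have hd : 0 < dist x y := dist_pos.mpr hxy
  set e : ℕ → ℝ := fun m => dist x y * (1 / ((m : ℝ) + 1)) with he
  have he0 : ∀ m, 0 < e m := fun m => by positivity
  have hele : ∀ m, e m ≤ dist x y := fun m => by
    refine mul_le_of_le_one_right hd.le ?_
    rw [div_le_one (by positivity)]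
    linarith [Nat.cast_nonneg (α := ℝ) m]
  have hlim : Tendsto e atTop (𝓝 0) := by
    rw [← mul_zero (dist x y)]
    exact tendsto_one_div_add_atTop_nhds_zero_nat.const_mul (dist x y)
  choose n v hv0 hvn hvK hvd hn using fun m =>
    exists_chain hK hKc hH hx hy (he0 m) (hele m)
  refine exists_isCurveTo_of_approx hK hT (l := fun _ => 4 * H) tendsto_const_nhds hlim
    (fun m t => v m ⌊t * n m⌋₊) (fun m t _ => hvK m _) ?_ (fun m => by simpa using hv0 m)
    (fun m => by simpa [hvn m] using hyT)
  intro m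
  have key : ∀ s ∈ Icc (0 : ℝ) 1, ∀ t ∈ Icc (0 : ℝ) 1, s ≤ t →
      dist (v m ⌊s * n m⌋₊) (v m ⌊t * n m⌋₊) ≤ 4 * H * |s - t| + e m := by
    intro s hs t ht hst
    have hs0 : 0 ≤ s * n m := mul_nonneg hs.1 (Nat.cast_nonneg _)
    have hle : ⌊s * n m⌋₊ ≤ ⌊t * n m⌋₊ := Nat.floor_le_floor (by gcongr)
    have h1 := dist_le_Ico_sum_of_dist_le (f := v m) (d := fun _ => e m) hle
      (fun _ _ => hvd m _)
    rw [Finset.sum_const, Nat.card_Ico, nsmul_eq_mul, Nat.cast_sub hle] at h1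
    have h2 : (⌊t * n m⌋₊ : ℝ) - ⌊s * n m⌋₊ ≤ n m * |s - t| + 1 := by
      have := Nat.floor_le (mul_nonneg ht.1 (Nat.cast_nonneg (n m)))
      have := Nat.lt_floor_add_one (s * n m)
      rw [abs_sub_comm, abs_of_nonneg (by linarith)]
      linarith
    have h3 := mul_le_mul_of_nonneg_right h2 (he0 m).le
    have h4 := mul_le_mul_of_nonneg_right (hn m) (abs_nonneg (s - t))
    linarith
  intro s hs t ht
  rcases le_total s t with h | h
  · exact key s hs t ht h
  · rw [dist_comm, abs_sub_comm]; exact key t ht s hs h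

/-- A Lipschitz curve with the least possible constant from `p` to `T` has no loops and meets `T`
only at its endpoint, since it could otherwise be shortened. -/
theorem exists_injective_isCurveTo {K T : Set Plane} (hK : IsCompact K) (hKc : IsPreconnected K)
    (hT : IsClosed T) (hH : Measure.hausdorffMeasure 1 K ≠ ⊤) (hTK : (T ∩ K).Nonempty)
    {p : Plane} (hp : p ∈ K) (hpT : p ∉ T) :
    ∃ (L : ℝ) (γ : ℝ → Plane), 0 ≤ L ∧ IsCurveTo K T p L γ ∧ InjOn γ (Icc 0 1) ∧
      ∀ t ∈ Icc (0 : ℝ) 1, γ t ∈ T → t = 1 := by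
  set S : Set ℝ := {L | ∃ γ, IsCurveTo K T p L γ} with hS
  have hS0 : ∀ L ∈ S, 0 < L := by
    rintro L ⟨γ, hγ⟩
    have h1 := hγ.dist_le 0 (by simp) 1 (by simp)
    have h2 : 0 < dist (γ 0) (γ 1) := by
      rw [dist_pos, hγ.zero]
      exact fun h => hpT (h ▸ hγ.one)
    simp only [zero_sub, abs_neg, abs_one, mul_one] at h1
    exact h2.trans_le h1
  have hSne : S.Nonempty := by
    obtain ⟨y, hyT, hyK⟩ := hTK
    obtain ⟨γ, hγ⟩ := exists_isCurveTo hK hKc hT (H := (Measure.hausdorffMeasure 1 K).toReal)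
      (by rw [ENNReal.ofReal_toReal hH]) hp hyK hyT (fun h => hpT (h ▸ hyT))
    exact ⟨_, γ, hγ⟩
  have hbdd : BddBelow S := ⟨0, fun L hL => (hS0 L hL).le⟩
  obtain ⟨l, -, hl, hlS⟩ := exists_seq_tendsto_sInf hSne hbdd
  choose g hg using hlS
  obtain ⟨γ, hγ⟩ := exists_isCurveTo_of_approx hK hT hl (e := fun _ => 0) tendsto_const_nhds g
    (fun m => (hg m).mem) (fun m s hs t ht => by simpa using (hg m).dist_le s hs t ht)
    (fun m => (hg m).zero) (fun m => (hg m).one)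
  set L := sInf S
  have hL0 : 0 < L := hS0 L ⟨γ, hγ⟩
  have hmin : ∀ L', ∀ γ', IsCurveTo K T p L' γ' → L ≤ L' := fun L' γ' h =>
    csInf_le hbdd ⟨γ', h⟩
  have hend : ∀ t ∈ Icc (0 : ℝ) 1, γ t ∈ T → t = 1 := by
    intro t ht htT
    have h1 : ∀ u ∈ Icc (0 : ℝ) 1, t * u ∈ Icc (0 : ℝ) 1 := fun u hu =>
      ⟨mul_nonneg ht.1 hu.1, mul_le_one₀ ht.2 hu.1 hu.2⟩
    -- Stopping at time `t` and reparametrising gives a curve with constant `L t`.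
    have h2 := hmin (L * t) (fun u => γ (t * u)) ⟨fun u hu => hγ.mem _ (h1 u hu), ?_, ?_, ?_⟩
    · exact le_antisymm ht.2 (by nlinarith)
    · intro u hu w hw
      have h3 := hγ.dist_le _ (h1 u hu) _ (h1 w hw)
      rwa [← mul_sub, abs_mul, abs_of_nonneg ht.1, ← mul_assoc] at h3
    · simpa using hγ.zero
    · simpa using htT
  refine ⟨L, γ, hL0.le, hγ, ?_, hend⟩
  have key : ∀ s ∈ Icc (0 : ℝ) 1, ∀ t ∈ Icc (0 : ℝ) 1, s < t → γ s ≠ γ t := by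
    intro s hs t ht hst heq
    -- Removing the loop between the times `s` and `t` leaves a curve of duration `c`.
    set c : ℝ := 1 - (t - s) with hc
    have hc0 : 0 ≤ c := by linarith [hs.1, ht.2]
    set γ' : ℝ → Plane := fun u => if c * u ≤ s then γ (c * u) else γ (c * u + (t - s)) with hγ'
    have hin1 : ∀ u ∈ Icc (0 : ℝ) 1, c * u ≤ s → c * u ∈ Icc (0 : ℝ) 1 := fun u hu h =>
      ⟨mul_nonneg hc0 hu.1, h.trans hs.2⟩
    have hin2 : ∀ u ∈ Icc (0 : ℝ) 1, c * u + (t - s) ∈ Icc (0 : ℝ) 1 := fun u hu =>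
      ⟨by have := mul_nonneg hc0 hu.1; linarith, by
        have := mul_le_of_le_one_right hc0 hu.2; linarith⟩
    have hdist : ∀ u ∈ Icc (0 : ℝ) 1, ∀ w ∈ Icc (0 : ℝ) 1, u ≤ w →
        dist (γ' u) (γ' w) ≤ L * c * |u - w| := by
      intro u hu w hw huw
      have hcuw : c * u ≤ c * w := by gcongr
      have habs : L * c * |u - w| = L * (c * w - c * u) := by
        rw [abs_sub_comm, abs_of_nonneg (by linarith)]; ring
      rw [habs]
      by_cases hws : c * w ≤ s
      · have hus := hcuw.trans hws
        have h1 := hγ.dist_le _ (hin1 u hu hus) _ (hin1 w hw hws)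
        rw [abs_sub_comm, abs_of_nonneg (by linarith)] at h1
        simpa only [hγ', if_pos hws, if_pos hus] using h1
      · by_cases hus : c * u ≤ s
        · simp only [hγ', if_neg hws, if_pos hus]
          have h1 := hγ.dist_le _ (hin1 u hu hus) _ hs
          have h2 := hγ.dist_le _ ht _ (hin2 w hw)
          rw [abs_sub_comm, abs_of_nonneg (by linarith)] at h1 h2
          have h3 := dist_triangle (γ (c * u)) (γ s) (γ (c * w + (t - s)))
          rw [heq] at h1 h3
          linarith
        · have h1 := hγ.dist_le _ (hin2 u hu) _ (hin2 w hw)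
          rw [abs_sub_comm, abs_of_nonneg (by linarith), add_sub_add_right_eq_sub] at h1
          simpa only [hγ', if_neg hws, if_neg hus] using h1
    have h2 := hmin (L * c) γ' ⟨fun u hu => ?_, fun u hu w hw => ?_, ?_, ?_⟩
    · nlinarith
    · simp only [hγ']
      split_ifs with h
      · exact hγ.mem _ (hin1 u hu h)
      · exact hγ.mem _ (hin2 u hu)
    · rcases le_total u w with h | h
      · exact hdist u hu w hw h
      · rw [dist_comm, abs_sub_comm]; exact hdist w hw u hu h
    · simp only [hγ', mul_zero, if_pos hs.1]; exact hγ.zero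
    · simp only [hγ', mul_one]
      split_ifs with h
      · have ht1 : t = 1 := le_antisymm ht.2 (by linarith)
        have hcs : c = s := by rw [hc, ht1]; ring
        rw [hcs, heq, ht1]; exact hγ.one
      · rw [hc, sub_add_cancel]; exact hγ.one
  intro s hs t ht heq
  rcases lt_trichotomy s t with h | h | h
  · exact absurd heq (key s hs t ht h)
  · exact h
  · exact absurd heq.symm (key t ht s hs h)

/-! ### The sharp tube bound for continua -/

/-- The area of every closed tube around `T` is at most that of a tube around a segment of length
`ℋ¹(T)`. -/
def HasTubeBound (T : Set Plane) : Prop :=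
  ∀ r : ℝ, 0 ≤ r → volume (Metric.cthickening r T) ≤
    ENNReal.ofReal (2 * r) * Measure.hausdorffMeasure 1 T + ENNReal.ofReal (Real.pi * r ^ 2)

theorem le_tubeBound_of_forall_pos {V c : ℝ≥0∞} (hc : c ≠ ⊤) {r : ℝ}
    (h : ∀ η : ℝ, 0 < η → V ≤
      ENNReal.ofReal (2 * (r + η)) * c + ENNReal.ofReal (Real.pi * (r + η) ^ 2)) :
    V ≤ ENNReal.ofReal (2 * r) * c + ENNReal.ofReal (Real.pi * r ^ 2) := by
  have hlim : Tendsto (fun η : ℝ =>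
      ENNReal.ofReal (2 * (r + η)) * c + ENNReal.ofReal (Real.pi * (r + η) ^ 2)) (𝓝[>] 0)
      (𝓝 (ENNReal.ofReal (2 * (r + 0)) * c + ENNReal.ofReal (Real.pi * (r + 0) ^ 2))) := by
    refine Tendsto.add (ENNReal.Tendsto.mul_const (ENNReal.tendsto_ofReal ?_) (Or.inr hc))
      (ENNReal.tendsto_ofReal ?_)
    · exact (Continuous.tendsto (f := fun η : ℝ => 2 * (r + η)) (by fun_prop) 0).mono_left
        nhdsWithin_le_nhds
    · exact (Continuous.tendsto (f := fun η : ℝ => Real.pi * (r + η) ^ 2) (by fun_prop)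
        0).mono_left nhdsWithin_le_nhds
  rw [add_zero] at hlim
  exact ge_of_tendsto hlim (eventually_nhdsWithin_of_forall h)

theorem hasTubeBound_singleton (x : Plane) : HasTubeBound {x} := by
  intro r hr
  rw [Metric.cthickening_singleton x hr, EuclideanSpace.volume_closedBall_fin_two,
    ← ENNReal.ofReal_pow hr, ← ENNReal.ofReal_mul (by positivity), mul_comm (r ^ 2)]
  exact le_add_self

/-- Tube bounds survive the attachment of a simple curve at one of its endpoints: the tube around
the curve, outside the disc around the attached endpoint, has area at most `2 r` times the length,
so no further half-discs are spent. -/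
theorem HasTubeBound.union_curve {T : Set Plane} (hT : HasTubeBound T)
    {γ : ℝ → Plane} {L : ℝ≥0} (hL : LipschitzOnWith L γ (Icc 0 1)) (hi : InjOn γ (Icc 0 1))
    (h1 : γ 1 ∈ T) (hmeet : ∀ t ∈ Icc (0 : ℝ) 1, γ t ∈ T → t = 1)
    (hfin : Measure.hausdorffMeasure 1 (T ∪ γ '' Icc 0 1) ≠ ⊤) :
    HasTubeBound (T ∪ γ '' Icc 0 1) := by
  have hγc : IsCompact (γ '' Icc 0 1) := isCompact_Icc.image_of_continuousOn hL.continuousOn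
  have hmeas : Measure.hausdorffMeasure 1 (T ∪ γ '' Icc 0 1) =
      Measure.hausdorffMeasure 1 T + Measure.hausdorffMeasure 1 (γ '' Icc 0 1) := by
    refine measure_union₀ hγc.measurableSet.nullMeasurableSet ?_
    have hsub : T ∩ γ '' Icc 0 1 ⊆ {γ 1} := by
      rintro _ ⟨h, t, ht, rfl⟩
      rw [hmeet t ht h, mem_singleton_iff]
    have := Measure.nullSingletonClass_hausdorff Plane one_pos
    exact measure_mono_null hsub (measure_singleton _)
  intro r hr
  refine le_tubeBound_of_forall_pos hfin fun η hη => ?_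
  have hsub : Metric.cthickening r (T ∪ γ '' Icc 0 1) ⊆ Metric.cthickening (r + η) T ∪
      (Metric.cthickening r (γ '' Icc 0 1) \ Metric.closedBall (γ 1) (r + η)) := by
    rw [Metric.cthickening_union]
    rintro x (hx | hx)
    · exact Or.inl (Metric.cthickening_mono (by linarith) _ hx)
    · by_cases hx1 : x ∈ Metric.closedBall (γ 1) (r + η)
      · exact Or.inl (Metric.closedBall_subset_cthickening h1 _ hx1)
      · exact Or.inr ⟨hx, hx1⟩
  refine (measure_mono hsub).trans ((measure_union_le _ _).trans ?_)
  refine (add_le_add (hT (r + η) (by positivity))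
    (volume_cthickening_curve_diff_le hL hi hr hη)).trans_eq ?_
  rw [hmeas, mul_add]
  ring

/-- Finitely many points of a continuum of finite length lie in a tree of simple curves inside it,
built by joining one point after the other to the part already constructed. -/
theorem exists_hasTubeBound_of_finset {K : Set Plane} (hK : IsCompact K) (hKc : IsConnected K)
    (hH : Measure.hausdorffMeasure 1 K ≠ ⊤) (N : Finset Plane) (hN : ↑N ⊆ K) :
    ∃ T, IsCompact T ∧ T ⊆ K ∧ T.Nonempty ∧ ↑N ⊆ T ∧ HasTubeBound T := by
  induction N using Finset.induction_on with
  | empty =>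
    obtain ⟨x, hx⟩ := hKc.nonempty
    exact ⟨{x}, isCompact_singleton, singleton_subset_iff.mpr hx, singleton_nonempty x,
      by simp, hasTubeBound_singleton x⟩
  | insert p N _ ih =>
    rw [Finset.coe_insert, insert_subset_iff] at hN
    obtain ⟨T, hTc, hTK, hTne, hNT, hT⟩ := ih hN.2
    rw [Finset.coe_insert]
    by_cases hpT : p ∈ T
    · exact ⟨T, hTc, hTK, hTne, insert_subset hpT hNT, hT⟩
    obtain ⟨L, γ, hL0, hγ, hi, hmeet⟩ := exists_injective_isCurveTo hK hKc.isPreconnected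
      hTc.isClosed hH (by rwa [inter_eq_left.mpr hTK]) hN.1 hpT
    have hL : LipschitzOnWith L.toNNReal γ (Icc 0 1) := by
      refine LipschitzOnWith.of_dist_le_mul fun s hs t ht => ?_
      rw [Real.coe_toNNReal L hL0, Real.dist_eq]
      exact hγ.dist_le s hs t ht
    have hsub : T ∪ γ '' Icc 0 1 ⊆ K := union_subset hTK (image_subset_iff.mpr hγ.mem)
    refine ⟨T ∪ γ '' Icc 0 1, hTc.union (isCompact_Icc.image_of_continuousOn hL.continuousOn),
      hsub, hTne.inl, insert_subset (Or.inr ⟨0, by simp, hγ.zero⟩)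
      (hNT.trans subset_union_left), hT.union_curve hL hi hγ.one hmeet ?_⟩
    exact ((measure_mono hsub).trans_lt (lt_top_iff_ne_top.mpr hH)).ne

/-- The sharp upper bound for the area of the tubes around a continuum: `K` lies within distance `η`
of a subtree that contains a finite `η`-net of `K`. -/
theorem IsConnected.hasTubeBound {K : Set Plane} (hKc : IsConnected K) (hK : IsCompact K)
    (hH : Measure.hausdorffMeasure 1 K ≠ ⊤) : HasTubeBound K := by
  intro r hr
  refine le_tubeBound_of_forall_pos hH fun η hη => ?_
  obtain ⟨N, hNK, hNf, hN⟩ := hK.finite_cover_balls hη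
  lift N to Finset Plane using hNf
  obtain ⟨T, hTc, hTK, -, hNT, hT⟩ := exists_hasTubeBound_of_finset hK hKc hH N hNK
  have hsub : Metric.cthickening r K ⊆ Metric.cthickening (r + η) T := by
    rw [hK.cthickening_eq_biUnion_closedBall hr]
    refine iUnion₂_subset fun y hy x hx => ?_
    obtain ⟨z, hz, hyz⟩ := mem_iUnion₂.mp (hN hy)
    refine Metric.closedBall_subset_cthickening (hNT hz) _ ?_
    exact (dist_triangle x y z).trans (add_le_add hx (le_of_lt hyz))
  refine (measure_mono hsub).trans ((hT _ (by positivity)).trans ?_)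
  gcongr

/-! ### Exponential integrals of the distance function -/

theorem mem_cthickening_iff_infDist_le {K : Set Plane} (hK : K.Nonempty) {r : ℝ} (hr : 0 ≤ r)
    {x : Plane} : x ∈ Metric.cthickening r K ↔ Metric.infDist x K ≤ r := by
  rw [Metric.mem_cthickening_iff, Metric.infDist,
    ENNReal.le_ofReal_iff_toReal_le (Metric.infEDist_ne_top hK) hr]

theorem lintegral_pow_mul_exp_neg_div (n : ℕ) {ε : ℝ} (hε : 0 < ε) :
    ∫⁻ t in Ioi (0 : ℝ), ENNReal.ofReal (t ^ n * Real.exp (-t / ε)) =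
      ENNReal.ofReal (n.factorial * ε ^ (n + 1)) := by
  have h1 := Real.integral_rpow_mul_exp_neg_mul_Ioi (a := n + 1) (r := ε⁻¹) (by positivity)
    (by positivity)
  have h2 : ∀ t : ℝ, t ^ ((n : ℝ) + 1 - 1) * Real.exp (-(ε⁻¹ * t)) =
      t ^ n * Real.exp (-t / ε) := by
    intro t
    rw [add_sub_cancel_right, Real.rpow_natCast]
    congr 2; ring
  simp only [h2] at h1
  have h3 : (1 / ε⁻¹) ^ ((n : ℝ) + 1) * Real.Gamma (n + 1) = n.factorial * ε ^ (n + 1) := by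
    rw [Real.Gamma_nat_eq_factorial, one_div, inv_inv, mul_comm]
    congr 1
    exact_mod_cast Real.rpow_natCast ε (n + 1)
  rw [h3] at h1
  rw [← h1, ofReal_integral_eq_lintegral_ofReal]
  · exact Integrable.of_integral_ne_zero (by rw [h1]; positivity)
  · refine (ae_restrict_mem measurableSet_Ioi).mono fun t ht => ?_
    have : 0 < t := ht
    positivity

/-- The layer-cake formula turns a tube bound into a bound for the exponential tail of the
distance function; the constant is sharp up to the term `π ε`. -/
theorem HasTubeBound.lintegral_exp_infDist_le {K : Set Plane} (hK : HasTubeBound K)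
    (hne : K.Nonempty) {ε : ℝ} (hε : 0 < ε) :
    ∫⁻ x : Plane, ENNReal.ofReal (Real.exp (-Metric.infDist x K / ε) / (2 * ε)) ≤
      Measure.hausdorffMeasure 1 K + ENNReal.ofReal (Real.pi * ε) := by
  set w : ℝ → ℝ≥0∞ := fun t => ENNReal.ofReal (Real.exp (-t / ε) / (2 * ε ^ 2)) with hw
  have hwm : Measurable w := by fun_prop
  have hlayer : ∀ d : ℝ, 0 ≤ d → ENNReal.ofReal (Real.exp (-d / ε) / (2 * ε)) =
      ∫⁻ t in Ioi 0, (Ioi d).indicator w t := by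
    intro d hd
    rw [setLIntegral_indicator measurableSet_Ioi, inter_eq_left.mpr (Ioi_subset_Ioi hd)]
    have h1 : ∫ t in Ioi d, Real.exp (-t / ε) / (2 * ε ^ 2) = Real.exp (-d / ε) / (2 * ε) := by
      have h2 := integral_exp_mul_Ioi (a := -ε⁻¹) (by simpa using hε) d
      have h3 : ∀ t, Real.exp (-ε⁻¹ * t) = Real.exp (-t / ε) := fun t => by congr 1; ring
      simp only [h3] at h2
      rw [integral_div, h2]
      field_simp
    rw [← h1, ofReal_integral_eq_lintegral_ofReal]
    · exact Integrable.of_integral_ne_zero (by rw [h1]; positivity)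
    · exact Eventually.of_forall fun t => by positivity
  have hmeas : Measurable (fun z : Plane × ℝ => (Ioi (Metric.infDist z.1 K)).indicator w z.2) := by
    have : (fun z : Plane × ℝ => (Ioi (Metric.infDist z.1 K)).indicator w z.2) =
        {z : Plane × ℝ | Metric.infDist z.1 K < z.2}.indicator (fun z => w z.2) := by
      ext z; simp [indicator]
    rw [this]
    refine (hwm.comp measurable_snd).indicator (IsOpen.measurableSet ?_)
    exact isOpen_lt ((Metric.continuous_infDist_pt K).comp continuous_fst) continuous_snd
  calc ∫⁻ x : Plane, ENNReal.ofReal (Real.exp (-Metric.infDist x K / ε) / (2 * ε))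
      = ∫⁻ x : Plane, ∫⁻ t in Ioi (0 : ℝ), (Ioi (Metric.infDist x K)).indicator w t :=
        lintegral_congr fun x => hlayer _ Metric.infDist_nonneg
    _ = ∫⁻ t in Ioi (0 : ℝ), ∫⁻ x : Plane, (Ioi (Metric.infDist x K)).indicator w t :=
        lintegral_lintegral_swap hmeas.aemeasurable
    -- For fixed `t`, the integrand is `w t` on a subset of the tube of radius `t` and zero elsewhere.
    _ ≤ ∫⁻ t in Ioi (0 : ℝ), (ENNReal.ofReal (ε ^ 2)⁻¹ * Measure.hausdorffMeasure 1 K *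
          ENNReal.ofReal (t ^ 1 * Real.exp (-t / ε)) +
          ENNReal.ofReal (Real.pi * (2 * ε ^ 2)⁻¹) *
          ENNReal.ofReal (t ^ 2 * Real.exp (-t / ε))) := by
        refine setLIntegral_mono (by fun_prop) fun t ht => ?_
        have ht0 : (0 : ℝ) < t := ht
        have h1 : ∀ x : Plane, (Ioi (Metric.infDist x K)).indicator w t ≤
            (Metric.cthickening t K).indicator (fun _ => w t) x := by
          intro x
          by_cases hx : Metric.infDist x K < t
          · rw [indicator_of_mem (show t ∈ Ioi _ from hx), indicator_of_mem
              ((mem_cthickening_iff_infDist_le hne ht0.le).mpr hx.le)]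
          · rw [indicator_of_notMem (show t ∉ Ioi _ from hx)]
            exact zero_le
        refine (lintegral_mono h1).trans ?_
        rw [lintegral_indicator_const Metric.isClosed_cthickening.measurableSet]
        refine (mul_le_mul_right (hK t ht0.le) _).trans_eq ?_
        have e1 : w t * ENNReal.ofReal (2 * t) =
            ENNReal.ofReal (ε ^ 2)⁻¹ * ENNReal.ofReal (t ^ 1 * Real.exp (-t / ε)) := by
          rw [← ENNReal.ofReal_mul (by positivity), ← ENNReal.ofReal_mul (by positivity)]
          congr 1; field_simp
        have e2 : w t * ENNReal.ofReal (Real.pi * t ^ 2) =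
            ENNReal.ofReal (Real.pi * (2 * ε ^ 2)⁻¹) *
              ENNReal.ofReal (t ^ 2 * Real.exp (-t / ε)) := by
          rw [← ENNReal.ofReal_mul (by positivity), ← ENNReal.ofReal_mul (by positivity)]
          congr 1; field_simp
        rw [mul_add, ← mul_assoc, e1, e2]
        ring
    _ = Measure.hausdorffMeasure 1 K + ENNReal.ofReal (Real.pi * ε) := by
        rw [lintegral_add_left (by fun_prop), lintegral_const_mul _ (by fun_prop),
          lintegral_const_mul _ (by fun_prop), lintegral_pow_mul_exp_neg_div 1 hε,
          lintegral_pow_mul_exp_neg_div 2 hε, mul_right_comm,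
          ← ENNReal.ofReal_mul (by positivity), ← ENNReal.ofReal_mul (by positivity)]
        have h1 : (ε ^ 2)⁻¹ * (Nat.factorial 1 * ε ^ (1 + 1)) = 1 := by
          simp only [Nat.factorial_one]; field_simp; norm_num
        have h2 : Real.pi * (2 * ε ^ 2)⁻¹ * (Nat.factorial 2 * ε ^ (2 + 1)) = Real.pi * ε := by
          simp only [Nat.factorial_two]; field_simp; norm_num
        rw [h1, h2, ENNReal.ofReal_one, one_mul]

/-! ### The exponential profile -/

/-- By Rademacher's theorem and integration by parts for Lipschitz functions. -/
theorem LipschitzWith.isWeakGradientOn_gradient {f : Plane → ℝ} {C : ℝ≥0}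
    (hf : LipschitzWith C f) : IsWeakGradientOn f (gradient f) univ := by
  have hmeas : Measurable (gradient f) :=
    (InnerProductSpace.toDual ℝ Plane).symm.continuous.measurable.comp (measurable_fderiv ℝ f)
  have hnorm : ∀ x, ‖gradient f x‖ ≤ C := fun x => by
    rw [gradient, LinearIsometryEquiv.norm_map]
    exact norm_fderiv_le_of_lipschitz ℝ hf
  refine ⟨hf.continuous.locallyIntegrable.locallyIntegrableOn _, ?_, ?_⟩
  · exact ((memLp_top_of_bound hmeas.aestronglyMeasurable C
      (Eventually.of_forall hnorm)).locallyIntegrable le_top).locallyIntegrableOn _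
  · intro η hη hηc _ e
    obtain ⟨D, hD⟩ := hη.lipschitzWith_of_hasCompactSupport hηc (by simp)
    have h1 := hf.integral_lineDeriv_mul_eq (μ := volume) hD hηc e
    have h2 : ∫ x, lineDeriv ℝ f x e * η x = ∫ x, inner ℝ (gradient f x) e * η x := by
      refine integral_congr_ae ?_
      filter_upwards [hf.ae_differentiableAt (μ := volume)] with x hx
      rw [hx.lineDeriv_eq_fderiv, gradient, InnerProductSpace.toDual_symm_apply]
    have h3 : ∀ x, lineDeriv ℝ η x (-e) * f x = -(f x * fderiv ℝ η x e) := by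
      intro x
      rw [(hη.differentiable (by simp) x).lineDeriv_eq_fderiv, map_neg]
      ring
    rw [h2] at h1
    simp only [h3, integral_neg] at h1
    linarith

theorem LipschitzWith.memH1Loc {f : Plane → ℝ} {C : ℝ≥0} (hf : LipschitzWith C f) :
    MemH1Loc f := by
  refine ⟨(hf.continuous.pow 2).locallyIntegrable, gradient f, hf.isWeakGradientOn_gradient, ?_⟩
  have hmeas : Measurable (gradient f) :=
    (InnerProductSpace.toDual ℝ Plane).symm.continuous.measurable.comp (measurable_fderiv ℝ f)
  refine (memLp_top_of_bound (hmeas.norm.pow_const 2).aestronglyMeasurable (C ^ 2)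
    (Eventually.of_forall fun x => ?_)).locallyIntegrable le_top
  rw [norm_pow, norm_norm, gradient, LinearIsometryEquiv.norm_map]
  gcongr
  exact norm_fderiv_le_of_lipschitz ℝ hf

theorem abs_exp_sub_exp_le {u v m : ℝ} (hu : u ≤ m) (hv : v ≤ m) :
    |Real.exp u - Real.exp v| ≤ Real.exp m * |u - v| := by
  have key : ∀ {u v : ℝ}, u ≤ m → v ≤ u → |Real.exp u - Real.exp v| ≤ Real.exp m * |u - v| := by
    intro u v hu hvu
    rw [abs_of_nonneg (sub_nonneg.mpr (Real.exp_le_exp.mpr hvu)),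
      abs_of_nonneg (sub_nonneg.mpr hvu)]
    have h1 : Real.exp v = Real.exp u * Real.exp (v - u) := by rw [← Real.exp_add]; congr 1; ring
    have h2 := Real.add_one_le_exp (v - u)
    have h3 : Real.exp u - Real.exp v ≤ Real.exp u * (u - v) := by
      rw [h1]; nlinarith [Real.exp_pos u]
    exact h3.trans (mul_le_mul_of_nonneg_right (Real.exp_le_exp.mpr hu) (sub_nonneg.mpr hvu))
  rcases le_total v u with h | h
  · exact key hu h
  · rw [abs_sub_comm, abs_sub_comm u]; exact key hv h

/-- The normalisation `(1 - k) / (1 - q)`, `q = e^{-a_ε / (2 ε)}`, of the truncated exponential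
profile. For `ε < 1` one has `q = ε`. -/
noncomputable def profileAmp (ε k : ℝ) : ℝ := (1 - k) / (1 - Real.exp (-aPar ε / (2 * ε)))

/-- The function of the distance `d` to `K` that equals `k` for `d ≤ b_ε`, equals `1` for
`d ≥ a_ε + b_ε`, and is one minus a multiple of `e^{-(d - b_ε) / (2 ε)} - e^{-a_ε / (2 ε)}` in
between. For `ε = 1`, where `a_ε = 0`, the normalisation divides by zero and the function is
constantly `1`. -/
noncomputable def expProfile (K : Set Plane) (ε k : ℝ) (x : Plane) : ℝ :=
  1 - profileAmp ε k * max 0 (min (1 - Real.exp (-aPar ε / (2 * ε)))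
    (Real.exp ((bPar ε - Metric.infDist x K) / (2 * ε)) - Real.exp (-aPar ε / (2 * ε))))

theorem abs_expProfile_sub_le {K : Set Plane} {ε k : ℝ} (hε : 0 < ε) {x y : Plane} {d : ℝ}
    (hx : d ≤ Metric.infDist x K) (hy : d ≤ Metric.infDist y K) :
    |expProfile K ε k x - expProfile K ε k y| ≤
      |profileAmp ε k| * Real.exp ((bPar ε - d) / (2 * ε)) / (2 * ε) * dist x y := by
  set q := Real.exp (-aPar ε / (2 * ε))
  set e : Plane → ℝ := fun x => Real.exp ((bPar ε - Metric.infDist x K) / (2 * ε)) with he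
  have h1 : |max 0 (min (1 - q) (e x - q)) - max 0 (min (1 - q) (e y - q))| ≤ |e x - e y| := by
    refine (abs_max_sub_max_le_max _ _ _ _).trans (max_le (by simp) ?_)
    refine (abs_min_sub_min_le_max _ _ _ _).trans (max_le (by simp) ?_)
    rw [sub_sub_sub_cancel_right]
  have h2 : |e x - e y| ≤ Real.exp ((bPar ε - d) / (2 * ε)) * (dist x y / (2 * ε)) := by
    refine (abs_exp_sub_exp_le (m := (bPar ε - d) / (2 * ε)) (by gcongr) (by gcongr)).trans ?_
    gcongr
    rw [← sub_div, abs_div, abs_of_pos (by positivity : 0 < 2 * ε), sub_sub_sub_cancel_left]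
    gcongr
    have := (Metric.lipschitz_infDist_pt K).dist_le_mul y x
    rwa [Real.dist_eq, NNReal.coe_one, one_mul, dist_comm] at this
  have h3 : expProfile K ε k x - expProfile K ε k y = -(profileAmp ε k *
      (max 0 (min (1 - q) (e x - q)) - max 0 (min (1 - q) (e y - q)))) := by
    simp only [expProfile, he, q]; ring
  rw [h3, abs_neg, abs_mul]
  refine (mul_le_mul_of_nonneg_left (h1.trans h2) (abs_nonneg _)).trans_eq ?_
  ring

theorem lipschitzWith_expProfile (K : Set Plane) {ε : ℝ} (k : ℝ) (hε : 0 < ε) :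
    ∃ C, LipschitzWith C (expProfile K ε k) := by
  refine ⟨(|profileAmp ε k| * Real.exp ((bPar ε - 0) / (2 * ε)) / (2 * ε)).toNNReal,
    LipschitzWith.of_dist_le_mul fun x y => ?_⟩
  rw [Real.coe_toNNReal _ (by positivity), Real.dist_eq]
  exact abs_expProfile_sub_le hε Metric.infDist_nonneg Metric.infDist_nonneg

/-- The truncation does not increase the gradient, so the bound of the untruncated exponential holds
at every point, also where the distance is at most `b_ε`. -/
theorem norm_gradient_expProfile_le (K : Set Plane) {ε : ℝ} (k : ℝ) (hε : 0 < ε) (x : Plane) :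
    ‖gradient (expProfile K ε k) x‖ ≤
      |profileAmp ε k| * Real.exp ((bPar ε - Metric.infDist x K) / (2 * ε)) / (2 * ε) := by
  set d := Metric.infDist x K
  -- Nearby points have distance at least `d - η` from `K`.
  have h1 : ∀ η : ℝ, 0 < η → ‖gradient (expProfile K ε k) x‖ ≤
      |profileAmp ε k| * Real.exp ((bPar ε - (d - η)) / (2 * ε)) / (2 * ε) := by
    intro η hη
    rw [gradient, LinearIsometryEquiv.norm_map]
    refine norm_fderiv_le_of_lip' ℝ (by positivity) ?_
    have h2 : ∀ᶠ y in 𝓝 x, d - η < Metric.infDist y K :=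
      (Metric.continuous_infDist_pt K).continuousAt.eventually (lt_mem_nhds (by
        simp only [d]; linarith))
    filter_upwards [h2] with y hy
    rw [Real.norm_eq_abs, ← dist_eq_norm]
    exact abs_expProfile_sub_le hε hy.le (by simp only [d]; linarith)
  have h3 : Tendsto (fun η : ℝ =>
      |profileAmp ε k| * Real.exp ((bPar ε - (d - η)) / (2 * ε)) / (2 * ε)) (𝓝[>] 0)
      (𝓝 (|profileAmp ε k| * Real.exp ((bPar ε - (d - 0)) / (2 * ε)) / (2 * ε))) :=
    (Continuous.tendsto (by fun_prop) 0).mono_left nhdsWithin_le_nhds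
  rw [sub_zero] at h3
  exact ge_of_tendsto h3 (eventually_nhdsWithin_of_forall h1)

theorem aPar_nonneg {ε : ℝ} (hε : 0 < ε) : 0 ≤ aPar ε := by
  unfold aPar; positivity

theorem exp_neg_aPar_lt_one {ε : ℝ} (hε : 0 < ε) (h1 : ε ≠ 1) :
    Real.exp (-aPar ε / (2 * ε)) < 1 := by
  have hlog : 0 < |Real.log ε| := abs_pos.mpr (Real.log_ne_zero_of_pos_of_ne_one hε h1)
  have : 0 < aPar ε := by unfold aPar; positivity
  rw [Real.exp_lt_one_iff, neg_div, neg_lt_zero]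
  positivity

theorem isProfile_expProfile {K : Set Plane} (hK : K.Nonempty) {ε : ℝ} (k : ℝ) (hε : 0 < ε)
    (hε1 : ε ≠ 1) : IsProfile K ε k (expProfile K ε k) := by
  obtain ⟨C, hC⟩ := lipschitzWith_expProfile K k hε
  have hq := exp_neg_aPar_lt_one hε hε1
  have ha := aPar_nonneg hε
  have hb : 0 ≤ bPar ε := sq_nonneg ε
  refine ⟨hC.continuous, hC.memH1Loc, fun x hx => ?_, fun x hx => ?_⟩
  · rw [mem_cthickening_iff_infDist_le hK hb] at hx
    have h1 : 1 ≤ Real.exp ((bPar ε - Metric.infDist x K) / (2 * ε)) :=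
      Real.one_le_exp (div_nonneg (by linarith) (by positivity))
    rw [expProfile, min_eq_left (by linarith), max_eq_right (by linarith), profileAmp,
      div_mul_cancel₀ _ (by linarith)]
    ring
  · rw [mem_cthickening_iff_infDist_le hK (by positivity), not_le] at hx
    have h1 : Real.exp ((bPar ε - Metric.infDist x K) / (2 * ε)) ≤
        Real.exp (-aPar ε / (2 * ε)) := by
      gcongr; linarith
    rw [expProfile, max_eq_left ((min_le_right _ _).trans (by linarith))]
    ring

/-- The gradient and the potential term are each at most `A² e^{(b_ε - d) / ε} / (4 ε)`, where
`A = (1 - k) / (1 - q)` and `d` is the distance to `K`. -/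
theorem modicaMortola_expProfile_le {K : Set Plane} (hT : HasTubeBound K) (hK : K.Nonempty)
    {ε : ℝ} (k : ℝ) (hε : 0 < ε) :
    modicaMortola ε univ (expProfile K ε k) ≤
      ENNReal.ofReal (profileAmp ε k ^ 2 * Real.exp (bPar ε / ε)) *
        (Measure.hausdorffMeasure 1 K + ENNReal.ofReal (Real.pi * ε)) := by
  obtain ⟨C, hC⟩ := lipschitzWith_expProfile K k hε
  refine iInf₂_le_of_le (gradient (expProfile K ε k)) hC.isWeakGradientOn_gradient ?_
  rw [Measure.restrict_univ]
  refine le_trans ?_ (mul_le_mul_right (hT.lintegral_exp_infDist_le hK hε) _)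
  rw [← lintegral_const_mul' _ _ ENNReal.ofReal_ne_top]
  refine lintegral_mono fun x => ?_
  rw [← ENNReal.ofReal_mul (by positivity)]
  refine ENNReal.ofReal_le_ofReal ?_
  set d := Metric.infDist x K with hd
  set A := profileAmp ε k with hA
  set E := Real.exp ((bPar ε - d) / (2 * ε)) with hE
  have hE0 : 0 < E := Real.exp_pos _
  have hEE : E ^ 2 = Real.exp (bPar ε / ε) * Real.exp (-d / ε) := by
    rw [hE, ← Real.exp_nat_mul, ← Real.exp_add]
    congr 1; push_cast; field_simp; ring
  have h1 : ‖gradient (expProfile K ε k) x‖ ^ 2 ≤ (|A| * E / (2 * ε)) ^ 2 := by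
    gcongr
    exact norm_gradient_expProfile_le K k hε x
  have h2 : (1 - expProfile K ε k x) ^ 2 ≤ (A * E) ^ 2 := by
    rw [expProfile, sub_sub_cancel, mul_pow, mul_pow]
    gcongr
    refine max_le hE0.le ((min_le_right _ _).trans ?_)
    linarith [Real.exp_pos (-aPar ε / (2 * ε))]
  calc ε * ‖gradient (expProfile K ε k) x‖ ^ 2 + (1 - expProfile K ε k x) ^ 2 / (4 * ε)
      ≤ ε * (|A| * E / (2 * ε)) ^ 2 + (A * E) ^ 2 / (4 * ε) := by gcongr
    _ = A ^ 2 * E ^ 2 / (2 * ε) := by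
        rw [div_pow, mul_pow, sq_abs]; field_simp; ring
    _ = A ^ 2 * Real.exp (bPar ε / ε) * (Real.exp (-d / ε) / (2 * ε)) := by rw [hEE]; ring

theorem tendsto_profileAmp {k : ℝ → ℝ} (hk : Tendsto k (𝓝[>] 0) (𝓝 0)) :
    Tendsto (fun ε => profileAmp ε (k ε)) (𝓝[>] 0) (𝓝 1) := by
  have h1 : (fun ε => (1 - k ε) / (1 - ε)) =ᶠ[𝓝[>] 0] fun ε => profileAmp ε (k ε) := by
    filter_upwards [Ioo_mem_nhdsGT (zero_lt_one (α := ℝ))] with ε hε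
    have h2 : -aPar ε / (2 * ε) = Real.log ε := by
      have := hε.1
      rw [aPar, abs_of_neg (Real.log_neg hε.1 hε.2)]
      field_simp
    rw [profileAmp, h2, Real.exp_log hε.1]
  refine Tendsto.congr' h1 ?_
  have hid : Tendsto (fun ε : ℝ => ε) (𝓝[>] 0) (𝓝 0) := nhdsWithin_le_nhds
  have := (hk.const_sub 1).div (hid.const_sub 1) (by norm_num)
  rwa [sub_zero, div_one] at this

/-- The prefactor tends to `1` because `b_ε / ε = ε` and `q = ε`. -/
theorem limsup_modicaMortola_expProfile_le {K : Set Plane} (hK : IsCompact K)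
    (hKc : IsConnected K) {k : ℝ → ℝ} (hk : Tendsto k (𝓝[>] 0) (𝓝 0)) :
    limsup (fun ε => modicaMortola ε univ (expProfile K ε (k ε))) (𝓝[>] 0) ≤
      Measure.hausdorffMeasure 1 K := by
  rcases eq_or_ne (Measure.hausdorffMeasure 1 K) ⊤ with hH | hH
  · rw [hH]; exact le_top
  have hT := hKc.hasTubeBound hK hH
  have hid : Tendsto (fun ε : ℝ => ε) (𝓝[>] 0) (𝓝 0) := nhdsWithin_le_nhds
  have h1 : Tendsto (fun ε => profileAmp ε (k ε) ^ 2 * Real.exp (bPar ε / ε)) (𝓝[>] 0)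
      (𝓝 1) := by
    have h2 : (fun ε : ℝ => ε) =ᶠ[𝓝[>] 0] fun ε => bPar ε / ε := by
      filter_upwards [self_mem_nhdsWithin] with ε hε
      have : (0 : ℝ) < ε := hε
      rw [bPar]; field_simp
    have h3 := ((tendsto_profileAmp hk).pow 2).mul
      ((Real.continuous_exp.tendsto 0).comp (hid.congr' h2))
    simpa using h3
  have h4 : Tendsto (fun ε : ℝ => Measure.hausdorffMeasure 1 K + ENNReal.ofReal (Real.pi * ε))
      (𝓝[>] 0) (𝓝 (Measure.hausdorffMeasure 1 K)) := by
    have := (ENNReal.tendsto_ofReal (hid.const_mul Real.pi)).const_add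
      (Measure.hausdorffMeasure 1 K)
    simpa using this
  have h5 := ENNReal.Tendsto.mul (ENNReal.tendsto_ofReal h1) (Or.inl (by simp)) h4
    (Or.inr (by simp))
  rw [ENNReal.ofReal_one, one_mul] at h5
  rw [← h5.limsup_eq]
  refine limsup_le_limsup ?_
  filter_upwards [self_mem_nhdsWithin] with ε hε
  exact modicaMortola_expProfile_le hT hKc.nonempty _ hε

/-! ### Weak gradients and energies under dilation -/

theorem MeasureTheory.LocallyIntegrableOn.comp_smul {F : Type*} [NormedAddCommGroup F]
    {f : Plane → F} {U : Set Plane} (hU : IsOpen U) (hf : LocallyIntegrableOn f U volume)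
    {c : ℝ} (hc : c ≠ 0) :
    LocallyIntegrableOn (fun x => f (c • x)) ((fun x : Plane => c • x) ⁻¹' U) volume := by
  have hcont : Continuous (fun x : Plane => c • x) := continuous_const_smul c
  rw [locallyIntegrableOn_iff (hU.preimage hcont).isLocallyClosed]
  intro k hk hkc
  have hkc' := hkc.image hcont
  have h1 := hf.integrableOn_compact_subset (image_subset_iff.mpr hk) hkc'
  rw [← integrable_indicator_iff hkc'.measurableSet] at h1
  have h2 := h1.comp_smul hc
  rw [← integrable_indicator_iff hkc.measurableSet]
  convert! h2 using 2 with x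
  have hinj : Function.Injective (fun x : Plane => c • x) := smul_right_injective Plane hc
  by_cases hx : x ∈ k
  · rw [indicator_of_mem hx, indicator_of_mem (mem_image_of_mem _ hx)]
  · rw [indicator_of_notMem hx, indicator_of_notMem (fun h => hx (hinj.mem_set_image.mp h))]

namespace IsWeakGradientOn

variable {φ ψ : Plane → ℝ} {G G₁ G₂ : Plane → Plane} {U V : Set Plane}

theorem mono (h : IsWeakGradientOn φ G V) (hUV : U ⊆ V) : IsWeakGradientOn φ G U :=
  ⟨h.locInt.mono_set hUV, h.locInt_grad.mono_set hUV,
    fun η h1 h2 h3 e => h.integral_eq η h1 h2 (h3.trans hUV) e⟩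

theorem congr (hU : IsOpen U) (h : IsWeakGradientOn φ G U) (hφ : EqOn φ ψ U) :
    IsWeakGradientOn ψ G U := by
  refine ⟨?_, h.locInt_grad, fun η h1 h2 h3 e => ?_⟩
  · rw [locallyIntegrableOn_iff hU.isLocallyClosed]
    intro k hk hkc
    exact (h.locInt.integrableOn_compact_subset hk hkc).congr_fun (hφ.mono hk) hkc.measurableSet
  · rw [← h.integral_eq η h1 h2 h3 e]
    refine integral_congr_ae (Eventually.of_forall fun x => ?_)
    by_cases hx : x ∈ tsupport η
    · simp only [hφ (h3 hx)]
    · have : fderiv ℝ η x = 0 := by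
        by_contra hne
        exact hx (support_fderiv_subset ℝ hne)
      simp [this]

theorem integrable_smul (h : IsWeakGradientOn φ G U) {η : Plane → ℝ} (hη : Continuous η)
    (hηc : HasCompactSupport η) (hηU : tsupport η ⊆ U) : Integrable (fun x => η x • G x) := by
  have h1 : IntegrableOn (fun x => η x • G x) (tsupport η) :=
    (h.locInt_grad.integrableOn_compact_subset hηU hηc).continuousOn_smul hη.continuousOn hηc
  rw [integrableOn_iff_integrable_of_support_subset] at h1
  · exact h1
  · intro x hx
    refine subset_tsupport η fun h0 => hx ?_
    simp only [h0, zero_smul]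

/-- Weak gradients are unique up to null sets. -/
theorem ae_eq (hU : IsOpen U) (h₁ : IsWeakGradientOn φ G₁ U) (h₂ : IsWeakGradientOn φ G₂ U) :
    ∀ᵐ x, x ∈ U → G₁ x = G₂ x := by
  have h := hU.ae_eq_zero_of_integral_contDiff_smul_eq_zero (μ := volume)
    (h₁.locInt_grad.sub h₂.locInt_grad) (fun η hη hηc hηU => ?_)
  · filter_upwards [h] with x hx hxU
    exact sub_eq_zero.mp (hx hxU)
  · have i₁ := h₁.integrable_smul hη.continuous hηc hηU
    have i₂ := h₂.integrable_smul hη.continuous hηc hηU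
    simp only [Pi.sub_apply, smul_sub]
    rw [integral_sub i₁ i₂, sub_eq_zero]
    refine ext_inner_left ℝ fun e => ?_
    rw [← integral_inner i₁, ← integral_inner i₂]
    have e₁ := h₁.integral_eq η hη hηc hηU e
    rw [h₂.integral_eq η hη hηc hηU e, neg_inj] at e₁
    simp only [inner_smul_right, real_inner_comm (G₁ _) e, real_inner_comm (G₂ _) e]
    simpa only [mul_comm] using e₁.symm

theorem comp_smul (hU : IsOpen U) (h : IsWeakGradientOn φ G U) {c : ℝ} (hc : 0 < c) :
    IsWeakGradientOn (fun x => φ (c • x)) (fun x => c • G (c • x))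
      ((fun x : Plane => c • x) ⁻¹' U) := by
  refine ⟨h.locInt.comp_smul hU hc.ne', (h.locInt_grad.comp_smul hU hc.ne').smul c, ?_⟩
  intro η hη hηc hηU e
  -- The test function is transported by the same dilation.
  set θ : Plane → ℝ := fun y => η (c⁻¹ • y) with hθ
  have hθs : ContDiff ℝ ∞ θ := hη.comp (contDiff_const_smul _)
  have hθc : HasCompactSupport θ := hηc.comp_smul (inv_ne_zero hc.ne')
  have hθU : tsupport θ ⊆ U := by
    have h1 : tsupport θ ⊆ (fun y : Plane => c⁻¹ • y) ⁻¹' tsupport η :=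
      closure_minimal (fun y hy => subset_tsupport η hy)
        ((isClosed_tsupport η).preimage (continuous_const_smul _))
    intro y hy
    simpa [smul_smul, mul_inv_cancel₀ hc.ne'] using hηU (h1 hy)
  have hθx : ∀ x, θ (c • x) = η x := fun x => by
    simp only [hθ, smul_smul, inv_mul_cancel₀ hc.ne', one_smul]
  have hθd : ∀ x, fderiv ℝ η x e = c * fderiv ℝ θ (c • x) e := by
    intro x
    have h1 : (fun x => θ (c • x)) = η := funext hθx
    rw [← h1, fderiv_comp_smul]
    simp
  have e1 := h.integral_eq θ hθs hθc hθU e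
  have e2 := Measure.integral_comp_smul volume (fun y => φ y * fderiv ℝ θ y e) c
  have e3 := Measure.integral_comp_smul volume (fun y => inner ℝ (G y) e * θ y) c
  simp only [hθx] at e3
  have l1 : ∀ x, φ (c • x) * fderiv ℝ η x e = c * (φ (c • x) * fderiv ℝ θ (c • x) e) :=
    fun x => by rw [hθd]; ring
  have l2 : ∀ x, inner ℝ (c • G (c • x)) e * η x = c * (inner ℝ (G (c • x)) e * η x) :=
    fun x => by rw [real_inner_smul_left]; ring
  simp only [l1, l2, integral_const_mul]
  rw [e2, e3, e1, smul_neg, mul_neg]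

end IsWeakGradientOn

theorem MemH1Loc.comp_smul {φ : Plane → ℝ} (h : MemH1Loc φ) {c : ℝ} (hc : 0 < c) :
    MemH1Loc (fun x => φ (c • x)) := by
  obtain ⟨h1, G, hG, h2⟩ := h
  refine ⟨?_, fun x => c • G (c • x), ?_, ?_⟩
  · have := (h1.locallyIntegrableOn univ).comp_smul isOpen_univ hc.ne'
    rwa [preimage_univ, locallyIntegrableOn_univ] at this
  · simpa only [preimage_univ] using hG.comp_smul isOpen_univ hc
  · have := (h2.locallyIntegrableOn univ).comp_smul isOpen_univ hc.ne'
    rw [preimage_univ, locallyIntegrableOn_univ] at this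
    simp only [norm_smul, mul_pow]
    exact this.smul (‖c‖ ^ 2)

theorem setLIntegral_comp_smul (f : Plane → ℝ≥0∞) (U : Set Plane) {c : ℝ} (hc : c ≠ 0) :
    ∫⁻ x in (fun x : Plane => c • x) ⁻¹' U, f (c • x) =
      ENNReal.ofReal |(c ^ 2)⁻¹| * ∫⁻ y in U, f y := by
  have hemb : MeasurableEmbedding (fun x : Plane => c • x) := measurableEmbedding_const_smul₀ hc
  have hmap := Measure.map_addHaar_smul (volume : Measure Plane) hc
  rw [finrank_euclideanSpace_fin] at hmap
  rw [← hemb.lintegral_map, ← hemb.restrict_map, hmap, Measure.restrict_smul,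
    lintegral_smul_measure, smul_eq_mul]

/-- In the plane the Dirichlet energy is scale invariant and the potential energy decreases under
contraction. -/
theorem modicaMortola_contracted_le {ε δ : ℝ} (hε : 0 < ε) (hδ : 0 ≤ δ) {U : Set Plane}
    (hU : IsOpen U) (φ : Plane → ℝ) :
    modicaMortola ε ((1 + δ)⁻¹ • U) (contracted δ φ) ≤ modicaMortola ε U φ := by
  have hc : 0 < 1 + δ := by positivity
  refine le_iInf₂ fun G hG => ?_
  rw [← preimage_smul₀ hc.ne']
  refine iInf₂_le_of_le (fun x => (1 + δ) • G ((1 + δ) • x)) (hG.comp_smul hU hc) ?_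
  simp only [contracted]
  rw [setLIntegral_comp_smul (fun y => ENNReal.ofReal
    (ε * ‖(1 + δ) • G y‖ ^ 2 + (1 - φ y) ^ 2 / (4 * ε))) U hc.ne',
    ← lintegral_const_mul' _ _ ENNReal.ofReal_ne_top]
  refine lintegral_mono fun y => ?_
  rw [← ENNReal.ofReal_mul (abs_nonneg _)]
  refine ENNReal.ofReal_le_ofReal ?_
  rw [abs_of_nonneg (by positivity), norm_smul, Real.norm_of_nonneg hc.le, mul_pow, mul_add]
  have h1 : ((1 + δ) ^ 2)⁻¹ * (ε * ((1 + δ) ^ 2 * ‖G y‖ ^ 2)) = ε * ‖G y‖ ^ 2 := by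
    field_simp
  rw [h1]
  gcongr
  refine mul_le_of_le_one_left (by positivity) (inv_le_one_of_one_le₀ ?_)
  exact one_le_pow₀ (by linarith)

/-- The energy of a profile is carried by any open set containing the region where the profile
differs from `1`. -/
theorem modicaMortola_le_of_eq_one_off {ε : ℝ} {C V : Set Plane} (hC : IsClosed C)
    (hV : IsOpen V) (hCV : C ⊆ V) {φ : Plane → ℝ} (hφ : MemH1Loc φ) (h1 : ∀ x ∉ C, φ x = 1)
    (W : Set Plane) : modicaMortola ε W φ ≤ modicaMortola ε V φ := by
  obtain ⟨-, G₀, hG₀, -⟩ := hφ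
  refine le_iInf₂ fun G hG => ?_
  refine iInf₂_le_of_le G₀ (hG₀.mono (subset_univ W)) ?_
  -- Off `C` the function agrees with the constant `1`, whose gradient vanishes.
  have hzero : ∀ᵐ x, x ∈ Cᶜ → G₀ x = 0 := by
    have hone : IsWeakGradientOn φ (gradient fun _ : Plane => (1 : ℝ)) Cᶜ :=
      ((LipschitzWith.const (1 : ℝ)).isWeakGradientOn_gradient.mono (subset_univ Cᶜ)).congr
        hC.isOpen_compl fun x hx => (h1 x hx).symm
    filter_upwards [(hG₀.mono (subset_univ Cᶜ)).ae_eq hC.isOpen_compl hone] with x hx hxC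
    rw [hx hxC, gradient_fun_const]
  have hV' := (hG₀.mono (subset_univ V)).ae_eq hV hG
  refine (setLIntegral_le_lintegral W _).trans ?_
  rw [← lintegral_indicator hV.measurableSet]
  refine lintegral_mono_ae ?_
  filter_upwards [hzero, hV'] with x hx0 hxV
  by_cases hx : x ∈ V
  · rw [indicator_of_mem hx, hxV hx]
  · have hxC : x ∉ C := fun h => hx (hCV h)
    simp [hx0 hxC, h1 x hxC]

/-! ### Geometry of Lipschitz star domains -/

theorem dist_inv_norm_smul_le {x y : Plane} (hx : x ≠ 0) (hy : y ≠ 0) :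
    dist (‖x‖⁻¹ • x) (‖y‖⁻¹ • y) ≤ 2 * dist x y / ‖x‖ := by
  have hnx : 0 < ‖x‖ := norm_pos_iff.mpr hx
  have hny : 0 < ‖y‖ := norm_pos_iff.mpr hy
  have h1 : ‖x‖⁻¹ • x - ‖y‖⁻¹ • y = ‖x‖⁻¹ • ((x - y) + ((‖y‖ - ‖x‖) * ‖y‖⁻¹) • y) := by
    rw [smul_add, smul_sub, smul_smul, sub_mul, mul_inv_cancel₀ hny.ne', mul_sub, sub_smul,
      mul_one, ← mul_assoc, inv_mul_cancel₀ hnx.ne', one_mul]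
    abel
  have h2 : ‖((‖y‖ - ‖x‖) * ‖y‖⁻¹) • y‖ ≤ ‖x - y‖ := by
    rw [norm_smul, norm_mul, norm_inv, norm_norm, mul_assoc, inv_mul_cancel₀ hny.ne', mul_one,
      norm_sub_rev x y]
    exact abs_norm_sub_norm_le y x
  rw [dist_eq_norm, dist_eq_norm, h1, norm_smul, norm_inv, norm_norm, inv_mul_eq_div]
  gcongr
  linarith [norm_add_le (x - y) (((‖y‖ - ‖x‖) * ‖y‖⁻¹) • y)]

theorem norm_inv_smul_mem_sphere {x : Plane} (hx : x ≠ 0) :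
    ‖x‖⁻¹ • x ∈ Metric.sphere (0 : Plane) 1 := by
  rw [mem_sphere_zero_iff_norm, norm_smul, norm_inv, norm_norm,
    inv_mul_cancel₀ (norm_ne_zero_iff.mpr hx)]

theorem norm_inv_smul_smul {s : ℝ} (hs : 0 < s) (x : Plane) :
    ‖s • x‖⁻¹ • s • x = ‖x‖⁻¹ • x := by
  rw [norm_smul, Real.norm_of_nonneg hs.le, mul_inv, smul_smul, mul_right_comm,
    inv_mul_cancel₀ hs.ne', one_mul]

namespace IsLipschitzStarDomain

variable {Ω : Set Plane}

/-- The infimum defining `radialLip` is attained. -/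
theorem lipschitzOnWith_radialLip (h : IsLipschitzStarDomain Ω) :
    LipschitzOnWith (radialLip Ω) (radial Ω) (Metric.sphere 0 1) := by
  refine LipschitzOnWith.of_dist_le_mul fun u hu v hv => ?_
  rcases eq_or_ne u v with rfl | huv
  · simp
  have hd : 0 < dist u v := dist_pos.mpr huv
  rw [← div_le_iff₀ hd]
  have h1 : (dist (radial Ω u) (radial Ω v) / dist u v).toNNReal ≤ radialLip Ω := by
    refine le_csInf h.lipschitz fun L hL => ?_
    rw [Real.toNNReal_le_iff_le_coe, div_le_iff₀ hd]
    exact hL.dist_le_mul u hu v hv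
  exact Real.toNNReal_le_iff_le_coe.mp h1

theorem frontier_nonempty (h : IsLipschitzStarDomain Ω) : (frontier Ω).Nonempty := by
  rw [nonempty_frontier_iff]
  refine ⟨⟨0, h.zero_mem⟩, fun huniv => ?_⟩
  exact NormedSpace.unbounded_univ ℝ Plane (huniv ▸ h.isBounded)

theorem cConst_pos (h : IsLipschitzStarDomain Ω) : 0 < cConst Ω := by
  refine div_pos ((isClosed_frontier.notMem_iff_infDist_pos h.frontier_nonempty).mp ?_)
    (by norm_num)
  rw [h.isOpen.frontier_eq]
  exact fun h0 => h0.2 h.zero_mem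

theorem CConst_pos (h : IsLipschitzStarDomain Ω) : 0 < CConst Ω := by
  have := h.cConst_pos
  unfold CConst
  positivity

theorem mem_closure_of_norm_le {x : Plane} (h : IsLipschitzStarDomain Ω) (hx : x ≠ 0)
    (hle : ‖x‖ ≤ radial Ω (‖x‖⁻¹ • x)) : x ∈ closure Ω := by
  have hn : 0 < ‖x‖ := norm_pos_iff.mpr hx
  have hlim : Tendsto (fun s : ℝ => s • x) (𝓝[<] 1) (𝓝 ((1 : ℝ) • x)) :=
    (Continuous.tendsto (by fun_prop) 1).mono_left nhdsWithin_le_nhds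
  rw [one_smul] at hlim
  refine mem_closure_of_tendsto hlim ?_
  filter_upwards [Ioo_mem_nhdsLT (zero_lt_one (α := ℝ))] with s hs
  rw [h.mem_iff (smul_ne_zero hs.1.ne' hx), norm_inv_smul_smul hs.1, norm_smul,
    Real.norm_of_nonneg hs.1.le]
  nlinarith [hs.2]

theorem four_mul_cConst_le_radial (h : IsLipschitzStarDomain Ω) {x : Plane} (hx : x ≠ 0) :
    4 * cConst Ω ≤ radial Ω (‖x‖⁻¹ • x) := by
  set u := ‖x‖⁻¹ • x with hu
  have hun : ‖u‖ = 1 := mem_sphere_zero_iff_norm.mp (norm_inv_smul_mem_sphere hx)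
  have hpos : 0 < radial Ω u := by
    have hlim : Tendsto (fun s : ℝ => s • x) (𝓝[>] 0) (𝓝 ((0 : ℝ) • x)) :=
      (Continuous.tendsto (by fun_prop) 0).mono_left nhdsWithin_le_nhds
    rw [zero_smul] at hlim
    obtain ⟨s, hsΩ, hs⟩ := ((hlim.eventually (h.isOpen.mem_nhds h.zero_mem)).and
      self_mem_nhdsWithin).exists
    have hs0 : 0 < s := hs
    have := (h.mem_iff (smul_ne_zero hs0.ne' hx)).mp hsΩ
    rw [norm_inv_smul_smul hs0] at this
    exact (norm_nonneg _).trans_lt this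
  have hu0 : u ≠ 0 := norm_ne_zero_iff.mp (by rw [hun]; norm_num)
  -- The boundary point in direction `u`.
  set z := radial Ω u • u with hz
  have hz0 : z ≠ 0 := smul_ne_zero hpos.ne' hu0
  have hzn : ‖z‖ = radial Ω u := by
    rw [hz, norm_smul, hun, mul_one, Real.norm_of_nonneg hpos.le]
  have hzu : ‖z‖⁻¹ • z = u := by rw [hz, norm_inv_smul_smul hpos, hun, inv_one, one_smul]
  have hzf : z ∈ frontier Ω := by
    rw [h.isOpen.frontier_eq]
    refine ⟨h.mem_closure_of_norm_le hz0 (by rw [hzu, hzn]), fun hzΩ => ?_⟩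
    have := (h.mem_iff hz0).mp hzΩ
    rw [hzu, hzn] at this
    exact lt_irrefl _ this
  have h1 := Metric.infDist_le_dist_of_mem (x := (0 : Plane)) hzf
  rw [dist_zero_left, hzn] at h1
  unfold cConst
  linarith

theorem mem_of_norm_lt (h : IsLipschitzStarDomain Ω) {x : Plane} (hx : ‖x‖ < 4 * cConst Ω) :
    x ∈ Ω := by
  rcases eq_or_ne x 0 with rfl | hx0
  · exact h.zero_mem
  · exact (h.mem_iff hx0).mpr (hx.trans_le (h.four_mul_cConst_le_radial hx0))

/-- If `y` is not beyond the boundary in its direction, then `x` is hardly beyond it: normalisation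
to the unit circle has Lipschitz constant `2 / |x|` at `x`. -/
theorem norm_le_radial_add (h : IsLipschitzStarDomain Ω) {x y : Plane} (hx : x ≠ 0) (hy : y ≠ 0)
    (hle : ‖y‖ ≤ radial Ω (‖y‖⁻¹ • y)) :
    ‖x‖ ≤ radial Ω (‖x‖⁻¹ • x) + (1 + 2 * radialLip Ω / ‖x‖) * dist x y := by
  have h1 := h.lipschitzOnWith_radialLip.dist_le_mul _ (norm_inv_smul_mem_sphere hx) _
    (norm_inv_smul_mem_sphere hy)
  have h2 := mul_le_mul_of_nonneg_left (dist_inv_norm_smul_le hx hy) (radialLip Ω).coe_nonneg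
  have h3 := (abs_le.mp ((Real.dist_eq _ _).symm.le.trans (h1.trans h2))).1
  have h4 : ‖x‖ - ‖y‖ ≤ dist x y := by rw [dist_eq_norm]; exact norm_sub_norm_le x y
  have h5 : (1 + 2 * radialLip Ω / ‖x‖) * dist x y =
      dist x y + radialLip Ω * (2 * dist x y / ‖x‖) := by ring
  rw [h5]
  linarith

theorem norm_le_radial_of_mem_closure (h : IsLipschitzStarDomain Ω) {x : Plane} (hx : x ≠ 0)
    (hxΩ : x ∈ closure Ω) : ‖x‖ ≤ radial Ω (‖x‖⁻¹ • x) := by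
  have hn : 0 < ‖x‖ := norm_pos_iff.mpr hx
  set A := 1 + 2 * (radialLip Ω : ℝ) / ‖x‖ with hA
  have hA0 : 0 < A := by positivity
  refine le_of_forall_pos_le_add fun η hη => ?_
  obtain ⟨y, hyΩ, hxy⟩ := Metric.mem_closure_iff.mp hxΩ (min (η / A) ‖x‖) (by positivity)
  have hy0 : y ≠ 0 := by
    rintro rfl
    rw [dist_zero_right] at hxy
    exact absurd (hxy.trans_le (min_le_right _ _)) (lt_irrefl _)
  refine (h.norm_le_radial_add hx hy0 ((h.mem_iff hy0).mp hyΩ).le).trans ?_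
  have := (lt_div_iff₀' hA0).mp (hxy.trans_le (min_le_left _ _))
  linarith

/-- Moving a point of the closure by `r ≤ c(Ω)` raises the norm above the radial function by at
most `(1 + 8 Lip(g_Ω) / c(Ω)) r`, strictly less if the Lipschitz constant is positive. The
contraction with factor `1 + δ` gains at least `4 δ c(Ω)`. -/
theorem inv_smul_mem_of_dist_le (h : IsLipschitzStarDomain Ω) {x y : Plane} {r δ : ℝ}
    (hy : y ∈ closure Ω) (hxy : dist x y ≤ r) (hr0 : 0 < r) (hr : r ≤ cConst Ω) (hδ : 0 < δ)
    (hδr : CConst Ω * r ≤ δ) :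
    (1 + δ)⁻¹ • x ∈ closure Ω ∧
      (0 < radialLip Ω ∨ CConst Ω * r < δ → (1 + δ)⁻¹ • x ∈ Ω) := by
  have hc := h.cConst_pos
  set c := cConst Ω with hcdef
  have hδ1 : 0 < 1 + δ := by positivity
  -- The disc of radius `4 c` lies in `Ω`; outside it, `1 / |x|` is under control.
  rcases lt_or_ge ‖x‖ (4 * c) with hxc | hxc
  · have hmem : (1 + δ)⁻¹ • x ∈ Ω := by
      refine h.mem_of_norm_lt (lt_of_le_of_lt ?_ hxc)
      rw [norm_smul, Real.norm_of_nonneg (by positivity)]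
      exact mul_le_of_le_one_left (norm_nonneg x) (inv_le_one_of_one_le₀ (by linarith))
    exact ⟨subset_closure hmem, fun _ => hmem⟩
  have hn : 0 < ‖x‖ := by linarith
  have hx0 : x ≠ 0 := norm_pos_iff.mp hn
  have hy0 : y ≠ 0 := by
    rintro rfl
    rw [dist_zero_right] at hxy
    linarith
  set l : ℝ := ((radialLip Ω : ℝ≥0) : ℝ) with hl
  have hl0 : 0 ≤ l := (radialLip Ω).coe_nonneg
  set g := radial Ω (‖x‖⁻¹ • x) with hg
  have h1 := h.norm_le_radial_add hx0 hy0 (h.norm_le_radial_of_mem_closure hy0 hy)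
  have h2 : (1 + 2 * l / ‖x‖) * dist x y ≤ (1 + l / c) * r := by
    have h7 : 2 * l / ‖x‖ ≤ l / c := by
      rw [div_le_div_iff₀ hn hc]
      nlinarith
    exact mul_le_mul (by linarith) hxy dist_nonneg (by positivity)
  have h3 : 4 * c * δ ≤ g * δ :=
    mul_le_mul_of_nonneg_right (h.four_mul_cConst_le_radial hx0) hδ.le
  -- Since `4 c C = 1 + 8 l / c`, the hypothesis on `δ` leaves `7 l r / c` to spare.
  have h4 : 4 * c * (CConst Ω * r) = (1 + l / c) * r + 7 * (l / c * r) := by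
    rw [CConst, ← hcdef, ← hl]; field_simp; ring
  have h5 : 4 * c * (CConst Ω * r) ≤ 4 * c * δ := by gcongr
  have h6 : 0 ≤ l / c * r := by positivity
  have hne : (1 + δ)⁻¹ • x ≠ 0 := smul_ne_zero (by positivity) hx0
  have hnorm : ‖(1 + δ)⁻¹ • x‖ = ‖x‖ / (1 + δ) := by
    rw [norm_smul, Real.norm_of_nonneg (by positivity), inv_mul_eq_div]
  constructor
  · refine h.mem_closure_of_norm_le hne ?_
    rw [norm_inv_smul_smul (by positivity), hnorm, div_le_iff₀ hδ1]
    linarith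
  · intro hcase
    rw [h.mem_iff hne, norm_inv_smul_smul (by positivity), hnorm, div_lt_iff₀ hδ1]
    rcases hcase with hL | hlt
    · have hL' : 0 < l := by exact_mod_cast hL
      have : 0 < l / c * r := by positivity
      linarith
    · have : 4 * c * (CConst Ω * r) < 4 * c * δ := by gcongr
      linarith

theorem smul_notMem_closure (h : IsLipschitzStarDomain Ω) {x : Plane} (hx : x ∈ frontier Ω)
    {s : ℝ} (hs : 1 < s) : s • x ∉ closure Ω := by
  rw [h.isOpen.frontier_eq] at hx
  have hx0 : x ≠ 0 := fun h0 => hx.2 (h0 ▸ h.zero_mem)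
  have hs0 : 0 < s := by linarith
  have h1 := mt (h.mem_iff hx0).mpr hx.2
  intro hmem
  have h2 := h.norm_le_radial_of_mem_closure (smul_ne_zero hs0.ne' hx0) hmem
  rw [norm_inv_smul_smul hs0, norm_smul, Real.norm_of_nonneg hs0.le] at h2
  nlinarith [norm_pos_iff.mpr hx0]

end IsLipschitzStarDomain

/-! ### Recovery profiles and their contractions -/

theorem mainTheorem8 :
    (∀ (K : Set Plane), IsCompact K → IsConnected K →
      ∀ k : ℝ → ℝ, Tendsto k (𝓝[>] 0) (𝓝 0) →
        ∃ φ : ℝ → Plane → ℝ,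
          (∀ ε : ℝ, 0 < ε → ε ≠ 1 → IsProfile K ε (k ε) (φ ε)) ∧
          limsup (fun ε => modicaMortola ε univ (φ ε)) (𝓝[>] 0) ≤ Measure.hausdorffMeasure 1 K) ∧
    (∀ (Ω : Set Plane), IsLipschitzStarDomain Ω →
      0 < cConst Ω ∧ 0 < CConst Ω ∧
      ∀ (K : Set Plane), IsClosed K → IsConnected K → K ⊆ closure Ω →
      ∀ (ε : ℝ), 0 < ε → aPar ε + bPar ε ≤ cConst Ω →
      ∀ (k : ℝ) (φ : Plane → ℝ), IsProfile K ε k φ →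
      ∀ (δ : ℝ), 0 < δ → δ < 1 → CConst Ω * (aPar ε + bPar ε) ≤ δ →
        (1 + δ)⁻¹ • Metric.cthickening (aPar ε + bPar ε) K ⊆ closure Ω ∧
        ((0 < radialLip Ω ∨ CConst Ω * (aPar ε + bPar ε) < δ) →
          (1 + δ)⁻¹ • Metric.cthickening (aPar ε + bPar ε) K ⊆ Ω) ∧
        Continuous (contracted δ φ) ∧ MemH1Loc (contracted δ φ) ∧
        (∀ x ∈ frontier Ω, contracted δ φ x = 1) ∧
        (∀ V : Set Plane, IsOpen V → Metric.cthickening (aPar ε + bPar ε) K ⊆ V →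
          modicaMortola ε Ω (contracted δ φ) ≤ modicaMortola ε V φ) ∧
        modicaMortola ε ((1 + δ)⁻¹ • Ω) (contracted δ φ) ≤ modicaMortola ε Ω φ) := by
  refine ⟨fun K hK hKc k hk => ⟨fun ε => expProfile K ε (k ε), fun ε hε hε1 =>
    isProfile_expProfile hKc.nonempty _ hε hε1, limsup_modicaMortola_expProfile_le hK hKc hk⟩,
    fun Ω h => ⟨h.cConst_pos, h.CConst_pos, ?_⟩⟩
  intro K hK _ hKΩ ε hε hεc k φ hφ δ hδ _ hδC
  have hδ1 : 0 < 1 + δ := by positivity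
  have hr : 0 < aPar ε + bPar ε := by
    have h1 := aPar_nonneg hε
    have h2 : 0 < bPar ε := pow_pos hε 2
    positivity
  have hKcomp : IsCompact K :=
    Metric.isCompact_of_isClosed_isBounded hK (h.isBounded.closure.subset hKΩ)
  have hmem : ∀ x ∈ Metric.cthickening (aPar ε + bPar ε) K, (1 + δ)⁻¹ • x ∈ closure Ω ∧
      (0 < radialLip Ω ∨ CConst Ω * (aPar ε + bPar ε) < δ → (1 + δ)⁻¹ • x ∈ Ω) := by
    intro x hx
    rw [hKcomp.cthickening_eq_biUnion_closedBall hr.le] at hx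
    obtain ⟨y, hy, hxy⟩ := mem_iUnion₂.mp hx
    exact h.inv_smul_mem_of_dist_le (hKΩ hy) hxy hr hεc hδ hδC
  refine ⟨?_, ?_, hφ.continuous.comp (continuous_const_smul _), hφ.memH1Loc.comp_smul hδ1,
    ?_, ?_, modicaMortola_contracted_le hε hδ.le h.isOpen φ⟩
  · rintro _ ⟨x, hx, rfl⟩
    exact (hmem x hx).1
  · rintro hcase _ ⟨x, hx, rfl⟩
    exact (hmem x hx).2 hcase
  · -- `(1 + δ) x` may lie on the boundary of the neighbourhood of `K`, but `s (1 + δ) x` lies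
    -- outside for all `s > 1`.
    intro x hx
    have hlim : Tendsto (fun s : ℝ => contracted δ φ (s • x)) (𝓝[>] 1)
        (𝓝 (contracted δ φ ((1 : ℝ) • x))) := by
      have hc : Continuous (fun s : ℝ => contracted δ φ (s • x)) :=
        hφ.continuous.comp (by fun_prop)
      exact (hc.tendsto 1).mono_left nhdsWithin_le_nhds
    rw [one_smul] at hlim
    refine tendsto_nhds_unique (hlim.congr' ?_) tendsto_const_nhds
    filter_upwards [self_mem_nhdsWithin] with s hs
    refine hφ.eq_outside _ fun hmem' => h.smul_notMem_closure hx hs ?_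
    simpa only [inv_smul_smul₀ hδ1.ne'] using (hmem _ hmem').1
  · intro V hV hKV
    have h1 := modicaMortola_contracted_le hε hδ.le (h.isOpen.smul₀ hδ1.ne') φ
    rw [inv_smul_smul₀ hδ1.ne'] at h1
    exact h1.trans (modicaMortola_le_of_eq_one_off Metric.isClosed_cthickening hV hKV hφ.memH1Loc
      hφ.eq_outside _)
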